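/- Work over $\mathbb{C}$ and let $0<k_1<k_2<n$ be integers. Let $\mathrm{Gr}(k,m)$ denote the Grassmannian of $k$-dimensional subspaces of $\mathbb{C}^m$, with tautological subbundle $\mathcal{U}$ (of rank $k$), tautological quotient bundle $\mathcal{Q}=\mathcal{O}^{\oplus m}/\mathcal{U}$ and $\mathcal{O}(-1)=\det\mathcal{U}$. For a vector bundle $E$ on $X$ let $\mathrm{Gr}_X(k,E)$ denote the Grassmann bundle of rank $k$ subbundles of $E$. Let $\mathrm{Fl}(k_1,k_2,n)$ be the two-step flag variety of subspaces $V_1\subset V_2\subset\mathbb{C}^n$ with $\dim V_i=k_i$, and let $\mathcal{U}_1$ and $\mathcal{Q}_2$ be the pullbacks to $\mathrm{Fl}(k_1,k_2,n)$ of the tautological subbundle of $\mathrm{Gr}(k_1,n)$ and of the tautological quotient bundle of $\mathrm{Gr}(k_2,n)$. For a vector bundle $\mathcal{F}$ on $\mathrm{Fl}(k_1,k_2,n)$, let $\mathscr{Z}(\mathcal{F})$ denote the (scheme-theoretic) zero locus of a general global section of $\mathcal{F}$, that is, of any section in a suitable nonempty Zariski open subset of the finite-dimensional vector space $H^0(\mathrm{Fl}(k_1,k_2,n),\mathcal{F})$.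 Then there are isomorphisms of schemes over $\mathbb{C}$ $$\mathscr{Z}(\mathcal{Q}_2)\;\cong\;\mathrm{Gr}_{\mathrm{Gr}(k_2-1,\,n-1)}\bigl(k_1,\ \overline{\mathcal{U}}\oplus\mathcal{O}\bigr),$$ $$\mathscr{Z}(\mathcal{U}_1^{\vee})\;\cong\;\mathrm{Gr}_{\mathrm{Gr}(k_1,\,n-1)}\bigl(k_2-k_1,\ \overline{\mathcal{Q}}(-1)\oplus\mathcal{O}(-1)\bigr),$$ where $\overline{\mathcal{U}}$ is the tautological subbundle on $\mathrm{Gr}(k_2-1,n-1)$ and $\overline{\mathcal{Q}}$ is the tautological quotient bundle on $\mathrm{Gr}(k_1,n-1)$. -/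

import Mathlib

open CategoryTheory

noncomputable section

/-! ### Semilinear base change -/

section BaseChange

variable {A B : Type} [CommRing A] [CommRing B]

/-- The `φ`-semilinear map `g : M → N` exhibits the `B`-module `N` as the extension of scalars
`B ⊗[A] M` of the `A`-module `M` along `φ : A →+* B`. -/
def IsExtension (φ : A →+* B) {M N : Type} [AddCommGroup M] [Module A M] [AddCommGroup N]
    [Module B N] (g : M →ₛₗ[φ] N) : Prop :=
  letI : Algebra A B := φ.toAlgebra
  letI : Module A N := Module.compHom N φ
  haveI : IsScalarTower A B N := ⟨fun a b n => mul_smul (φ a) b n⟩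
  IsBaseChange B
    ({ toFun := g, map_add' := map_add g, map_smul' := fun a m => g.map_smulₛₗ a m } : M →ₗ[A] N)

variable {φ : A →+* B} {M N : Type} [AddCommGroup M] [Module A M] [AddCommGroup N] [Module B N]
  {g : M →ₛₗ[φ] N}

theorem IsExtension.exists_lift (h : IsExtension φ g) {Q : Type} [AddCommGroup Q] [Module B Q]
    (k : M →ₛₗ[φ] Q) : ∃ k' : N →ₗ[B] Q, ∀ m, k' (g m) = k m := by
  let _ : Algebra A B := φ.toAlgebra
  let _ : Module A N := Module.compHom N φ
  have _ : IsScalarTower A B N := ⟨fun a b n => mul_smul (φ a) b n⟩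
  let _ : Module A Q := Module.compHom Q φ
  have _ : IsScalarTower A B Q := ⟨fun a b n => mul_smul (φ a) b n⟩
  exact ⟨IsBaseChange.lift h
    ({ toFun := k, map_add' := map_add k, map_smul' := fun a m => k.map_smulₛₗ a m } : M →ₗ[A] Q),
    fun m => IsBaseChange.lift_eq h _ m⟩

theorem IsExtension.span_eq_top (h : IsExtension φ g) : Submodule.span B (Set.range g) = ⊤ := by
  let _ : Algebra A B := φ.toAlgebra
  let _ : Module A N := Module.compHom N φ
  have _ : IsScalarTower A B N := ⟨fun a b n => mul_smul (φ a) b n⟩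
  rw [eq_top_iff]
  rintro x -
  induction x using IsBaseChange.inductionOn h with
  | zero => exact zero_mem _
  | tmul m => exact Submodule.subset_span ⟨m, rfl⟩
  | smul s n hn => exact Submodule.smul_mem _ s hn
  | add a b ha hb => exact add_mem ha hb

theorem IsExtension.hom_ext (h : IsExtension φ g) {Q : Type} [AddCommGroup Q] [Module B Q]
    {k₁ k₂ : N →ₗ[B] Q} (e : ∀ m, k₁ (g m) = k₂ (g m)) : k₁ = k₂ := by
  refine LinearMap.ext_on h.span_eq_top ?_
  rintro _ ⟨m, rfl⟩
  exact e m

theorem IsExtension.of_lift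
    (hs : Submodule.span B (Set.range g) = ⊤)
    (h : ∀ (Q : Type) [AddCommGroup Q] [Module B Q] (k : M →ₛₗ[φ] Q),
      ∃ k' : N →ₗ[B] Q, ∀ m, k' (g m) = k m) : IsExtension φ g := by
  let _ : Algebra A B := φ.toAlgebra
  let _ : Module A N := Module.compHom N φ
  have _ : IsScalarTower A B N := ⟨fun a b n => mul_smul (φ a) b n⟩
  refine IsBaseChange.of_lift_unique _ ?_
  intro Q _ _ _ _ k
  let _ : AddCommGroup Q := Module.addCommMonoidToAddCommGroup B
  obtain ⟨k', hk'⟩ := h Q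
    { toFun := k
      map_add' := map_add k
      map_smul' := fun a m => by
        change k (a • m) = φ a • k m
        rw [k.map_smul, ← algebraMap_smul B a (k m)]
        rfl }
  refine ⟨k', LinearMap.ext hk', ?_⟩
  intro k'' hk''
  refine LinearMap.ext_on hs ?_
  rintro _ ⟨m, rfl⟩
  exact (LinearMap.congr_fun hk'' m).trans (hk' m).symm

/-- A finite family generating `M` and `N`, with compatible coordinate functions. -/
theorem IsExtension.of_frame {ι : Type} [Fintype ι] (m : ι → M) (c : ι → M → A)
    (c' : ι → N →ₗ[B] B) (h : ∀ x, ∑ i, c i x • m i = x) (h' : ∀ y, ∑ i, c' i y • g (m i) = y)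
    (hc : ∀ i x, c' i (g x) = φ (c i x)) : IsExtension φ g := by
  refine IsExtension.of_lift ?_ ?_
  · rw [eq_top_iff]
    rintro y -
    rw [← h' y]
    exact Submodule.sum_mem _ fun i _ => Submodule.smul_mem _ _ (Submodule.subset_span ⟨_, rfl⟩)
  · intro Q _ _ k
    refine ⟨∑ i, (c' i).smulRight (k (m i)), fun x => ?_⟩
    conv_rhs => rw [← h x]
    simp [hc]

theorem IsExtension.exists_frame (hg : IsExtension φ g) [Module.Finite A M]
    [Module.Projective A M] :
    ∃ (r : ℕ) (m : Fin r → M) (c : Fin r → M →ₗ[A] A) (c' : Fin r → N →ₗ[B] B),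
      (∀ x, ∑ i, c i x • m i = x) ∧ (∀ y, ∑ i, c' i y • g (m i) = y) ∧
      ∀ i x, c' i (g x) = φ (c i x) := by
  obtain ⟨r, f, s, -, -, hfs⟩ := Module.Finite.exists_comp_eq_id_of_projective A M
  have hx : ∀ x, ∑ i, s x i • f (Pi.single i 1) = x := by
    intro x
    have : f (s x) = x := LinearMap.congr_fun hfs x
    conv_rhs => rw [← this, pi_eq_sum_univ' (s x)]
    simp only [map_sum, map_smul]
  let c : Fin r → M →ₗ[A] A := fun i => LinearMap.proj i ∘ₗ s
  choose c' hc' using fun i => hg.exists_lift (Q := B)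
    ({ toFun := fun x => φ (c i x)
       map_add' := fun x y => by simp
       map_smul' := fun a x => by simp } : M →ₛₗ[φ] B)
  refine ⟨r, fun i => f (Pi.single i 1), c, c', hx, ?_, fun i x => hc' i x⟩
  have key : (∑ i, (c' i).smulRight (g (f (Pi.single i 1)))) = LinearMap.id := by
    refine hg.hom_ext fun x => ?_
    have := congrArg g (hx x)
    simp only [map_sum, LinearMap.map_smulₛₗ] at this
    simpa [hc', c] using this
  intro y
  simpa using LinearMap.congr_fun key y

theorem IsExtension.finite (hg : IsExtension φ g) [Module.Finite A M] [Module.Projective A M] :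
    Module.Finite B N := by
  obtain ⟨r, m, c, c', -, h', -⟩ := hg.exists_frame
  refine Module.Finite.of_surjective (Fintype.linearCombination B fun i => g (m i)) fun y => ?_
  exact ⟨fun i => c' i y, by simpa [Fintype.linearCombination_apply] using h' y⟩

theorem IsExtension.projective (hg : IsExtension φ g) [Module.Finite A M]
    [Module.Projective A M] : Module.Projective B N := by
  obtain ⟨r, m, c, c', -, h', -⟩ := hg.exists_frame
  refine Module.Projective.of_split (LinearMap.pi c')
    (Fintype.linearCombination B fun i => g (m i)) ?_
  ext y
  simpa [Fintype.linearCombination_apply] using h' y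

theorem IsExtension.rankAtStalk_eq (hg : IsExtension φ g) [Module.Finite A M]
    [Module.Projective A M] (p : PrimeSpectrum B) :
    Module.rankAtStalk (R := B) N p = Module.rankAtStalk (R := A) M (p.comap φ) := by
  let _ : Algebra A B := φ.toAlgebra
  let _ : Module A N := Module.compHom N φ
  have _ : IsScalarTower A B N := ⟨fun a b n => mul_smul (φ a) b n⟩
  exact Module.rankAtStalk_isBaseChange hg p

/-- The submodule of `N` generated by the image of a submodule of `M`. -/
def extendSub (g : M →ₛₗ[φ] N) (L : Submodule A M) : Submodule B N := Submodule.span B (g '' L)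

theorem mem_extendSub (g : M →ₛₗ[φ] N) {L : Submodule A M} {x : M} (hx : x ∈ L) :
    g x ∈ extendSub g L := Submodule.subset_span ⟨x, hx, rfl⟩

/-- The map induced by a semilinear map on submodules. -/
def restrictSub (g : M →ₛₗ[φ] N) {L : Submodule A M} {L' : Submodule B N}
    (h : ∀ x ∈ L, g x ∈ L') : L →ₛₗ[φ] L' where
  toFun x := ⟨g x, h x x.2⟩
  map_add' x y := Subtype.ext (by simp)
  map_smul' a x := Subtype.ext (by simp)

theorem exists_retraction (L : Submodule A M) [Module.Projective A (M ⧸ L)] :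
    ∃ p : M →ₗ[A] L, ∀ x : L, p x = x := by
  obtain ⟨s, hs⟩ := Module.projective_lifting_property L.mkQ LinearMap.id L.mkQ_surjective
  have hs' : ∀ x, L.mkQ (s x) = x := LinearMap.congr_fun hs
  have hm : ∀ x, ((LinearMap.id : M →ₗ[A] M) - s ∘ₗ L.mkQ) x ∈ L := by
    intro x
    rw [← Submodule.Quotient.mk_eq_zero, ← Submodule.mkQ_apply]
    simp only [LinearMap.sub_apply, LinearMap.id_apply, LinearMap.comp_apply, map_sub, hs',
      sub_self]
  refine ⟨((LinearMap.id : M →ₗ[A] M) - s ∘ₗ L.mkQ).codRestrict L hm, fun x => Subtype.ext ?_⟩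
  · have : L.mkQ (x : M) = 0 := by simp
    simp only [LinearMap.codRestrict_apply, LinearMap.sub_apply, LinearMap.id_apply,
      LinearMap.comp_apply, this, map_zero, sub_zero]

theorem IsExtension.restrictSub_extendSub (hg : IsExtension φ g) [Module.Finite A M]
    [Module.Projective A M] (L : Submodule A M) [Module.Projective A (M ⧸ L)] :
    IsExtension φ (restrictSub g (L := L) (L' := extendSub g L)
      fun _ hx => mem_extendSub g hx) := by
  obtain ⟨r, m, c, c', h, h', hc⟩ := hg.exists_frame
  obtain ⟨p, hp⟩ := exists_retraction L
  have hsum : ∀ x : L, ∑ i, c i x • p (m i) = x := by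
    intro x
    have := congrArg p (h x)
    simpa [hp] using this
  refine IsExtension.of_frame (fun i => p (m i)) (fun i x => c i x)
    (fun i => (c' i) ∘ₗ (extendSub g L).subtype) hsum ?_ (fun i x => hc i x)
  intro y
  have key : ∀ y ∈ extendSub g L, ∑ i, c' i y • g (p (m i)) = y := by
    intro y hy
    induction hy using Submodule.span_induction with
    | mem _ hx =>
      obtain ⟨x, hx, rfl⟩ := hx
      have := congrArg g (congrArg Subtype.val (hsum ⟨x, hx⟩))
      simp only [AddSubmonoidClass.coe_finsetSum, Submodule.coe_smul, map_sum,
        LinearMap.map_smulₛₗ] at this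
      simpa [hc] using this
    | zero => simp
    | add a b _ _ ha hb =>
      simp only [map_add, add_smul, Finset.sum_add_distrib, ha, hb]
    | smul s a _ ha =>
      simp only [map_smul, smul_eq_mul, mul_smul, ← Finset.smul_sum, ha]
  refine Subtype.ext ?_
  have := key y y.2
  simpa [restrictSub] using this

/-- The map induced by a semilinear map on quotients. -/
def mapQuot (g : M →ₛₗ[φ] N) {L : Submodule A M} {L' : Submodule B N}
    (h : ∀ x ∈ L, g x ∈ L') : (M ⧸ L) →ₛₗ[φ] (N ⧸ L') :=
  L.mapQ L' g h

@[simp] theorem mapQuot_mk (g : M →ₛₗ[φ] N) {L : Submodule A M} {L' : Submodule B N}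
    (h : ∀ x ∈ L, g x ∈ L') (x : M) :
    mapQuot g h (Submodule.Quotient.mk x) = Submodule.Quotient.mk (g x) := rfl

theorem IsExtension.mapQuot_extendSub (hg : IsExtension φ g) (L : Submodule A M) :
    IsExtension φ (mapQuot g (L := L) (L' := extendSub g L) fun _ hx => mem_extendSub g hx) := by
  refine IsExtension.of_lift ?_ ?_
  · rw [eq_top_iff]
    rintro y -
    obtain ⟨y, rfl⟩ := Submodule.Quotient.mk_surjective _ y
    have hy : y ∈ Submodule.span B (Set.range g) := by rw [hg.span_eq_top]; trivial
    induction hy using Submodule.span_induction with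
    | mem _ hx =>
      obtain ⟨x, rfl⟩ := hx
      exact Submodule.subset_span ⟨Submodule.Quotient.mk x, rfl⟩
    | zero => exact zero_mem _
    | add a b _ _ ha hb => exact add_mem ha hb
    | smul s a _ ha => exact Submodule.smul_mem _ s ha
  · intro Q _ _ k
    obtain ⟨k', hk'⟩ := hg.exists_lift (k.comp L.mkQ)
    refine ⟨(extendSub g L).liftQ k' ?_, ?_⟩
    · refine Submodule.span_le.2 ?_
      rintro _ ⟨x, hx, rfl⟩
      have : (Submodule.Quotient.mk x : M ⧸ L) = 0 := (Submodule.Quotient.mk_eq_zero L).2 hx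
      simp [hk', this]
    · intro y
      obtain ⟨y, rfl⟩ := Submodule.Quotient.mk_surjective _ y
      exact hk' y

/-- The extension of scalars of linear forms. -/
def dualExt (hg : IsExtension φ g) : Module.Dual A M →ₛₗ[φ] Module.Dual B N :=
  have ex : ∀ l : Module.Dual A M, ∃ l' : Module.Dual B N, ∀ m, l' (g m) = φ (l m) := fun l =>
    hg.exists_lift (Q := B)
      ({ toFun := fun x => φ (l x)
         map_add' := fun x y => by simp
         map_smul' := fun a x => by simp } : M →ₛₗ[φ] B)
  { toFun := fun l => (ex l).choose
    map_add' := fun l₁ l₂ => hg.hom_ext fun m => by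
      rw [(ex (l₁ + l₂)).choose_spec, LinearMap.add_apply, LinearMap.add_apply,
        (ex l₁).choose_spec, (ex l₂).choose_spec, map_add]
    map_smul' := fun a l => hg.hom_ext fun m => by
      rw [(ex (a • l)).choose_spec, LinearMap.smul_apply, LinearMap.smul_apply,
        (ex l).choose_spec, smul_eq_mul, smul_eq_mul, map_mul] }

/-- The extended form is the unique linear form with this property. -/
theorem dualExt_apply (hg : IsExtension φ g) (l : Module.Dual A M) (m : M) :
    dualExt hg l (g m) = φ (l m) :=
  (hg.exists_lift (Q := B)
      ({ toFun := fun x => φ (l x)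
         map_add' := fun x y => by simp
         map_smul' := fun a x => by simp } : M →ₛₗ[φ] B)).choose_spec m

theorem IsExtension.dual (hg : IsExtension φ g) [Module.Finite A M] [Module.Projective A M] :
    IsExtension φ (dualExt hg) := by
  obtain ⟨r, m, c, c', h, h', hc⟩ := hg.exists_frame
  have hcc : ∀ i, dualExt hg (c i) = c' i := fun i => hg.hom_ext fun x => by
    rw [dualExt_apply, hc]
  refine IsExtension.of_frame c (fun i l => l (m i))
    (fun i => Module.Dual.eval B N (g (m i))) ?_ ?_ ?_
  · intro l
    ext x
    conv_rhs => rw [← h x]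
    simp [mul_comm]
  · intro l
    ext y
    conv_rhs => rw [← h' y]
    simp [hcc, mul_comm]
  · intro i l
    simp [dualExt_apply]

/-- The map induced by a semilinear map on exterior powers,
`v₁ ∧ ⋯ ∧ v_k ↦ g v₁ ∧ ⋯ ∧ g v_k`. -/
def exteriorExt (k : ℕ) (g : M →ₛₗ[φ] N) : (⋀[A]^k M) →ₛₗ[φ] (⋀[B]^k N) :=
  letI : Module A (⋀[B]^k N) := Module.compHom _ φ
  let a : M [⋀^Fin k]→ₗ[A] (⋀[B]^k N) :=
    { toFun := fun v => exteriorPower.ιMulti B k (g ∘ v)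
      map_update_add' := by
        intro _ v i x y
        simp only [Function.comp_update, map_add, AlternatingMap.map_update_add]
      map_update_smul' := by
        intro _ v i c x
        simp only [Function.comp_update, LinearMap.map_smulₛₗ, AlternatingMap.map_update_smul]
        rfl
      map_eq_zero_of_eq' := by
        intro v i j hv hij
        exact (exteriorPower.ιMulti B k).map_eq_zero_of_eq _ (by simp [hv]) hij }
  let l := exteriorPower.alternatingMapLinearEquiv a
  { toFun := l
    map_add' := map_add l
    map_smul' := fun c x => l.map_smul c x }

@[simp] theorem exteriorExt_ιMulti (k : ℕ) (g : M →ₛₗ[φ] N) (v : Fin k → M) :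
    exteriorExt k g (exteriorPower.ιMulti A k v) = exteriorPower.ιMulti B k (g ∘ v) := by
  let _ : Module A (⋀[B]^k N) := Module.compHom _ φ
  exact exteriorPower.alternatingMapLinearEquiv_apply_ιMulti _ v

theorem exterior_induction (k : ℕ) {P : (⋀[A]^k M) → Prop} (h0 : P 0)
    (hadd : ∀ x y, P x → P y → P (x + y)) (hsmul : ∀ (a : A) x, P x → P (a • x))
    (hι : ∀ v, P (exteriorPower.ιMulti A k v)) (x : ⋀[A]^k M) : P x := by
  have hx : x ∈ Submodule.span A (Set.range (exteriorPower.ιMulti A k (M := M))) := by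
    rw [exteriorPower.ιMulti_span]; trivial
  induction hx using Submodule.span_induction with
  | mem _ h => obtain ⟨v, rfl⟩ := h; exact hι v
  | zero => exact h0
  | add a b _ _ ha hb => exact hadd a b ha hb
  | smul s a _ ha => exact hsmul s a ha

theorem IsExtension.exterior (k : ℕ) (hg : IsExtension φ g) [Module.Finite A M]
    [Module.Projective A M] : IsExtension φ (exteriorExt k g) := by
  obtain ⟨r, m, c, c', h, h', hc⟩ := hg.exists_frame
  let b := Pi.basisFun A (Fin r)
  let b' := Pi.basisFun B (Fin r)
  let s : M →ₗ[A] (Fin r → A) := LinearMap.pi c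
  let s' : N →ₗ[B] (Fin r → B) := LinearMap.pi c'
  let t : (Fin r → A) →ₗ[A] M := Fintype.linearCombination A m
  let t' : (Fin r → B) →ₗ[B] N := Fintype.linearCombination B fun i => g (m i)
  have hts : t ∘ₗ s = LinearMap.id := LinearMap.ext fun x => by
    simpa [t, s, Fintype.linearCombination_apply] using h x
  have hts' : t' ∘ₗ s' = LinearMap.id := LinearMap.ext fun x => by
    simpa [t', s', Fintype.linearCombination_apply] using h' x
  have tb : ∀ i, t (b i) = m i := fun i => by simp [t, b, Fintype.linearCombination_apply_single]
  have tb' : ∀ i, t' (b' i) = g (m i) := fun i => by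
    simp [t', b', Fintype.linearCombination_apply_single]
  refine IsExtension.of_frame
    (fun I => exteriorPower.map k t (b.exteriorPower k I))
    (fun I x => exteriorPower.ιMultiDual A k b I (exteriorPower.map k s x))
    (fun I => exteriorPower.ιMultiDual B k b' I ∘ₗ exteriorPower.map k s') ?_ ?_ ?_
  · intro x
    have e := congrArg (exteriorPower.map k t) ((b.exteriorPower k).sum_repr
      (exteriorPower.map k s x))
    rw [← LinearMap.comp_apply (exteriorPower.map k t), ← exteriorPower.map_comp, hts,
      exteriorPower.map_id] at e
    simpa [exteriorPower.basis_repr_apply] using e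
  · intro y
    have e := congrArg (exteriorPower.map k t') ((b'.exteriorPower k).sum_repr
      (exteriorPower.map k s' y))
    rw [← LinearMap.comp_apply (exteriorPower.map k t'), ← exteriorPower.map_comp, hts',
      exteriorPower.map_id] at e
    have key : ∀ I, exteriorExt k g (exteriorPower.map k t (b.exteriorPower k I)) =
        exteriorPower.map k t' (b'.exteriorPower k I) := by
      intro I
      simp only [exteriorPower.basis_apply, exteriorPower.ιMulti_family,
        exteriorPower.map_apply_ιMulti, exteriorExt_ιMulti]
      congr 1
      ext i
      simp [tb, tb']
    simp only [key]
    simpa [exteriorPower.basis_repr_apply] using e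
  · intro I x
    induction x using exterior_induction with
    | h0 => simp
    | hadd x y hx hy => simp only [map_add, hx, hy]
    | hsmul a x hx =>
      simp only [LinearMap.map_smulₛₗ, map_smul, hx, smul_eq_mul, map_mul]
    | hι v =>
      simp only [exteriorExt_ιMulti, LinearMap.comp_apply, exteriorPower.map_apply_ιMulti,
        exteriorPower.ιMultiDual_apply_ιMulti, RingHom.map_det]
      congr 1
      ext i j
      simp [b, b', s, s', hc]

instance exterior_projective (k : ℕ) [Module.Finite A M] [Module.Projective A M] :
    Module.Projective A (⋀[A]^k M) := by
  obtain ⟨r, f, s, -, -, hfs⟩ := Module.Finite.exists_comp_eq_id_of_projective A M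
  refine Module.Projective.of_split (exteriorPower.map k s) (exteriorPower.map k f) ?_
  rw [← exteriorPower.map_comp, hfs, exteriorPower.map_id]

variable {M' N' : Type} [AddCommGroup M'] [Module A M'] [AddCommGroup N'] [Module B N']
  {g' : M' →ₛₗ[φ] N'}

/-- The map `(x, x') ↦ (g x, g' x')` on direct sums. -/
def prodExt (g : M →ₛₗ[φ] N) (g' : M' →ₛₗ[φ] N') : (M × M') →ₛₗ[φ] (N × N') where
  toFun x := (g x.1, g' x.2)
  map_add' x y := by simp
  map_smul' a x := by simp

theorem IsExtension.prod (hg : IsExtension φ g) (hg' : IsExtension φ g') :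
    IsExtension φ (prodExt g g') := by
  refine IsExtension.of_lift ?_ ?_
  · rw [eq_top_iff]
    rintro ⟨y, y'⟩ -
    have h₁ : Submodule.span B (Set.range g) ≤
        (Submodule.span B (Set.range (prodExt g g'))).comap (LinearMap.inl B N N') := by
      refine Submodule.span_le.2 ?_
      rintro _ ⟨x, rfl⟩
      exact Submodule.subset_span ⟨(x, 0), by simp [prodExt]⟩
    have h₂ : Submodule.span B (Set.range g') ≤
        (Submodule.span B (Set.range (prodExt g g'))).comap (LinearMap.inr B N N') := by
      refine Submodule.span_le.2 ?_
      rintro _ ⟨x, rfl⟩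
      exact Submodule.subset_span ⟨(0, x), by simp [prodExt]⟩
    rw [hg.span_eq_top] at h₁
    rw [hg'.span_eq_top] at h₂
    have h₃ : (y, (0 : N')) ∈ Submodule.span B (Set.range (prodExt g g')) :=
      h₁ (show y ∈ (⊤ : Submodule B N) from trivial)
    have h₄ : ((0 : N), y') ∈ Submodule.span B (Set.range (prodExt g g')) :=
      h₂ (show y' ∈ (⊤ : Submodule B N') from trivial)
    simpa using add_mem h₃ h₄
  · intro Q _ _ k
    obtain ⟨k₁, h₁⟩ := hg.exists_lift (k.comp (LinearMap.inl A M M'))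
    obtain ⟨k₂, h₂⟩ := hg'.exists_lift (k.comp (LinearMap.inr A M M'))
    refine ⟨k₁.coprod k₂, fun x => ?_⟩
    simp [prodExt, h₁, h₂, ← map_add]

/-- The map `x ⊗ x' ↦ g x ⊗ g' x'` on tensor products. -/
def tensorExt (g : M →ₛₗ[φ] N) (g' : M' →ₛₗ[φ] N') :
    (TensorProduct A M M') →ₛₗ[φ] (TensorProduct B N N') :=
  TensorProduct.map g g'

open TensorProduct in
theorem IsExtension.tensor (hg : IsExtension φ g) (hg' : IsExtension φ g') [Module.Finite A M]
    [Module.Projective A M] [Module.Finite A M'] [Module.Projective A M'] :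
    IsExtension φ (tensorExt g g') := by
  obtain ⟨r, m, c, d, h, h', hc⟩ := hg.exists_frame
  obtain ⟨r', m', c', d', k, k', hc'⟩ := hg'.exists_frame
  refine IsExtension.of_frame (ι := Fin r × Fin r') (fun i => m i.1 ⊗ₜ m' i.2)
    (fun i => LinearMap.mul' A A ∘ₗ TensorProduct.map (c i.1) (c' i.2))
    (fun i => LinearMap.mul' B B ∘ₗ TensorProduct.map (d i.1) (d' i.2)) ?_ ?_ ?_
  · intro x
    induction x with
    | zero => simp
    | add x y hx hy => simp only [map_add, add_smul, Finset.sum_add_distrib, hx, hy]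
    | tmul x y =>
      conv_rhs => rw [← h x, ← k y]
      rw [TensorProduct.sum_tmul]
      simp only [TensorProduct.tmul_sum, TensorProduct.smul_tmul_smul, Fintype.sum_prod_type]
      simp
  · intro x
    induction x with
    | zero => simp
    | add x y hx hy => simp only [map_add, add_smul, Finset.sum_add_distrib, hx, hy]
    | tmul x y =>
      conv_rhs => rw [← h' x, ← k' y]
      rw [TensorProduct.sum_tmul]
      simp only [TensorProduct.tmul_sum, TensorProduct.smul_tmul_smul, Fintype.sum_prod_type]
      simp [tensorExt]
  · intro i x
    induction x with
    | zero => simp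
    | add x y hx hy => simp only [map_add, hx, hy]
    | tmul x y => simp [tensorExt, hc, hc']

end BaseChange

/-! ### Complex spaces and vector bundles via functors of points

A scheme over `ℂ` is determined, up to unique isomorphism, by its functor of points on commutative
`ℂ`-algebras, and isomorphisms of `ℂ`-schemes are the same as natural isomorphisms between these
functors. All varieties below are given by their functors of points. -/

/-- Functors of points of spaces over `ℂ`. -/
abbrev CSpace := CommAlgCat.{0} ℂ ⥤ Type

/-- A vector bundle on `X`: a finitely generated projective `A`-module for each `A`-point of `X`,
compatible with extension of scalars. (For a scheme `X` this is the same as a locally free sheaf of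
finite rank, its module at `x : Spec A ⟶ X` being the global sections of the pullback along `x`.) -/
structure VectBundle (X : CSpace) where
  fib : ∀ {A : CommAlgCat.{0} ℂ}, X.obj A → Type
  [addCommGroup : ∀ {A : CommAlgCat.{0} ℂ} (x : X.obj A), AddCommGroup (fib x)]
  [module : ∀ {A : CommAlgCat.{0} ℂ} (x : X.obj A), Module A (fib x)]
  finite : ∀ {A : CommAlgCat.{0} ℂ} (x : X.obj A), Module.Finite A (fib x)
  projective : ∀ {A : CommAlgCat.{0} ℂ} (x : X.obj A), Module.Projective A (fib x)
  tr : ∀ {A B : CommAlgCat.{0} ℂ} (f : A ⟶ B) {x : X.obj A} {y : X.obj B}, X.map f x = y →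
    (fib x →ₛₗ[f.hom.toRingHom] fib y)
  tr_id : ∀ {A : CommAlgCat.{0} ℂ} {x : X.obj A} (h : X.map (𝟙 A) x = x) (v : fib x),
    tr (𝟙 A) h v = v
  tr_comp : ∀ {A B C : CommAlgCat.{0} ℂ} (f : A ⟶ B) (g : B ⟶ C) {x : X.obj A} {y : X.obj B}
    {z : X.obj C} (hf : X.map f x = y) (hg : X.map g y = z) (hfg : X.map (f ≫ g) x = z)
    (v : fib x), tr (f ≫ g) hfg v = tr g hg (tr f hf v)
  isExtension : ∀ {A B : CommAlgCat.{0} ℂ} (f : A ⟶ B) {x : X.obj A} {y : X.obj B}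
    (h : X.map f x = y), IsExtension f.hom.toRingHom (tr f h)

namespace VectBundle

attribute [instance] addCommGroup module finite projective

variable {X Y : CSpace}

/-- The trivial bundle of rank `n`. -/
def trivial (X : CSpace) (n : ℕ) : VectBundle X where
  fib {A} _ := Fin n → A
  finite _ := inferInstance
  projective _ := inferInstance
  tr {_ _} f {_ _} _ :=
    { toFun := fun v i => f.hom (v i)
      map_add' := fun v w => by ext i; simp
      map_smul' := fun a v => by ext i; simp }
  tr_id _ v := rfl
  tr_comp {_ _ _} f g {_ _ _} _ _ _ v := rfl
  isExtension {A B} f x y h := by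
    refine IsExtension.of_frame (fun i => Pi.single i 1) (fun i v => v i)
      (fun i => LinearMap.proj i) (fun v => ?_) (fun v => ?_) (fun i v => rfl)
    · ext j
      simp [Finset.sum_apply, Pi.single_apply]
    · ext j
      change (∑ i, v i • fun k => f.hom ((Pi.single i 1 : Fin n → A) k)) j = v j
      simp [Finset.sum_apply, Pi.single_apply, apply_ite]

/-- The structure sheaf `𝒪`. -/
def structureSheaf (X : CSpace) : VectBundle X where
  fib {A} _ := A
  finite _ := inferInstance
  projective _ := inferInstance
  tr {_ _} f {_ _} _ :=
    { toFun := f.hom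
      map_add' := fun v w => by simp
      map_smul' := fun a v => by simp }
  tr_id _ v := rfl
  tr_comp {_ _ _} f g {_ _ _} _ _ _ v := rfl
  isExtension {A B} f x y h := by
    refine IsExtension.of_frame (ι := Fin 1) (fun i => 1) (fun i v => v)
      (fun i => LinearMap.id) (fun v => ?_) (fun v => ?_) (fun i v => rfl)
    · simp
    · change ∑ _ : Fin 1, v • f.hom 1 = v
      simp

/-- The pullback of a bundle along a morphism. -/
def pullback (α : Y ⟶ X) (E : VectBundle X) : VectBundle Y where
  fib y := E.fib (α.app _ y)
  addCommGroup y := E.addCommGroup _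
  module y := E.module _
  finite y := E.finite _
  projective y := E.projective _
  tr {_ _} f {x y} h := E.tr f (by rw [← h]; exact (NatTrans.naturality_apply α f x).symm)
  tr_id _ v := E.tr_id _ v
  tr_comp {_ _ _} f g {_ _ _} _ _ _ v := E.tr_comp f g _ _ _ v
  isExtension {_ _} f {_ _} _ := E.isExtension f _

/-- The direct sum. -/
def sum (E F : VectBundle X) : VectBundle X where
  fib x := E.fib x × F.fib x
  finite _ := inferInstance
  projective _ := inferInstance
  tr {_ _} f {_ _} h := prodExt (E.tr f h) (F.tr f h)
  tr_id h v := Prod.ext (E.tr_id h v.1) (F.tr_id h v.2)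
  tr_comp {_ _ _} f g {_ _ _} h h' h'' v := Prod.ext (E.tr_comp f g h h' h'' v.1)
    (F.tr_comp f g h h' h'' v.2)
  isExtension {_ _} f {_ _} h := (E.isExtension f h).prod (F.isExtension f h)

/-- The tensor product. -/
def tensor (E F : VectBundle X) : VectBundle X where
  fib {A} x := TensorProduct A (E.fib x) (F.fib x)
  finite _ := inferInstance
  projective _ := inferInstance
  tr {_ _} f {_ _} h := tensorExt (E.tr f h) (F.tr f h)
  tr_id {A x} h v := by
    induction v with
    | zero => rw [map_zero]
    | add v w hv hw => rw [map_add, hv, hw]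
    | tmul v w => exact congrArg₂ (· ⊗ₜ[A] ·) (E.tr_id h v) (F.tr_id h w)
  tr_comp {_ _ C} f g {_ _ _} h h' h'' v := by
    induction v with
    | zero => rw [map_zero, map_zero, map_zero]
    | add v w hv hw => rw [map_add, map_add, map_add, hv, hw]
    | tmul v w => exact congrArg₂ (· ⊗ₜ[C] ·) (E.tr_comp f g h h' h'' v) (F.tr_comp f g h h' h'' w)
  isExtension {_ _} f {_ _} h := (E.isExtension f h).tensor (F.isExtension f h)

/-- The dual bundle. -/
def dual (E : VectBundle X) : VectBundle X where
  fib {A} x := Module.Dual A (E.fib x)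
  finite _ := inferInstance
  projective _ := inferInstance
  tr {_ _} f {_ _} h := dualExt (E.isExtension f h)
  tr_id h v := by
    ext m
    have := dualExt_apply (E.isExtension (𝟙 _) h) v m
    rw [E.tr_id] at this
    exact this
  tr_comp {_ _ _} f g {_ _ _} h h' h'' v := by
    refine (E.isExtension (f ≫ g) h'').hom_ext fun m => ?_
    rw [dualExt_apply, E.tr_comp f g h h' h'', dualExt_apply, dualExt_apply]
    rfl
  isExtension {_ _} f {_ _} h := (E.isExtension f h).dual

/-- The exterior powers. -/
def exterior (k : ℕ) (E : VectBundle X) : VectBundle X where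
  fib {A} x := ⋀[A]^k (E.fib x)
  finite _ := inferInstance
  projective _ := inferInstance
  tr {_ _} f {_ _} h := exteriorExt k (E.tr f h)
  tr_id {A x} h v := by
    induction v using exterior_induction with
    | h0 => rw [map_zero]
    | hadd v w hv hw => rw [map_add, hv, hw]
    | hsmul a v hv => rw [LinearMap.map_smulₛₗ, hv]; rfl
    | hι v =>
      rw [exteriorExt_ιMulti]
      exact congrArg _ (funext fun i => E.tr_id h (v i))
  tr_comp {_ _ _} f g {_ _ _} h h' h'' v := by
    induction v using exterior_induction with
    | h0 => rw [map_zero, map_zero, map_zero]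
    | hadd v w hv hw => rw [map_add, map_add, map_add, hv, hw]
    | hsmul a v hv =>
      rw [LinearMap.map_smulₛₗ, LinearMap.map_smulₛₗ, LinearMap.map_smulₛₗ, hv]; rfl
    | hι v =>
      rw [exteriorExt_ιMulti, exteriorExt_ιMulti, exteriorExt_ιMulti]
      exact congrArg _ (funext fun i => E.tr_comp f g h h' h'' (v i))
  isExtension {_ _} f {_ _} h := (E.isExtension f h).exterior k

/-! ### Global sections, zero loci -/

instance complexModule (E : VectBundle X) {A : CommAlgCat.{0} ℂ} (x : X.obj A) :
    Module ℂ (E.fib x) := Module.compHom _ (algebraMap ℂ A)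

/-- The complex vector space `H⁰(X, E)` of global sections. -/
def globalSections (E : VectBundle X) :
    Submodule ℂ (∀ (A : CommAlgCat.{0} ℂ) (x : X.obj A), E.fib x) where
  carrier := {s | ∀ (A B : CommAlgCat.{0} ℂ) (f : A ⟶ B) (x : X.obj A) (y : X.obj B)
    (h : X.map f x = y), E.tr f h (s A x) = s B y}
  add_mem' := by
    intro s t hs ht A B f x y h
    exact (map_add (E.tr f h) _ _).trans (congrArg₂ (· + ·) (hs A B f x y h) (ht A B f x y h))
  zero_mem' := by
    intro A B f x y h
    exact map_zero (E.tr f h)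
  smul_mem' := by
    intro c s hs A B f x y h
    change E.tr f h (algebraMap ℂ A c • s A x) = algebraMap ℂ B c • s B y
    rw [LinearMap.map_smulₛₗ, hs A B f x y h]
    congr 1
    exact f.hom.commutes c

/-- The scheme-theoretic zero locus of a global section. -/
def zeroLocus {E : VectBundle X} (s : E.globalSections) : Subfunctor X where
  obj A := {x | s.1 A x = 0}
  map {A B} f x hx := by
    change s.1 B (X.map f x) = 0
    rw [← s.2 A B f x _ rfl, show s.1 A x = 0 from hx, map_zero]

end VectBundle

/-- `P` holds for a general element of the complex vector space `V`: `V` is finite-dimensional and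
`P` holds on a nonempty Zariski-open subset, namely where some nonzero polynomial in linear
coordinates does not vanish. -/
def HoldsForGeneral {V : Type*} [AddCommGroup V] [Module ℂ V] (P : V → Prop) : Prop :=
  ∃ (m : ℕ) (b : Module.Basis (Fin m) ℂ V) (p : MvPolynomial (Fin m) ℂ), p ≠ 0 ∧
    ∀ v : V, MvPolynomial.eval (b.equivFun v) p ≠ 0 → P v

/-! ### Grassmann bundles -/

/-- `L ⊆ M` is a subbundle of rank `k`: a direct summand, locally free of rank `k`. -/
structure IsSubbundle {A M : Type} [CommRing A] [AddCommGroup M] [Module A M] (k : ℕ)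
    (L : Submodule A M) : Prop where
  projective_quotient : Module.Projective A (M ⧸ L)
  rank_eq : ∀ p : PrimeSpectrum A, Module.rankAtStalk (R := A) L p = k

theorem IsSubbundle.finite_projective {A M : Type} [CommRing A] [AddCommGroup M] [Module A M]
    [Module.Finite A M] [Module.Projective A M] {k : ℕ} {L : Submodule A M}
    (h : IsSubbundle k L) : Module.Finite A L ∧ Module.Projective A L := by
  have := h.projective_quotient
  obtain ⟨p, hp⟩ := exists_retraction L
  exact ⟨Module.Finite.of_surjective p fun x => ⟨x, hp x⟩,
    Module.Projective.of_split L.subtype p (LinearMap.ext hp)⟩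

theorem IsSubbundle.extend {A B M N : Type} [CommRing A] [CommRing B] {φ : A →+* B}
    [AddCommGroup M] [Module A M] [AddCommGroup N] [Module B N] {g : M →ₛₗ[φ] N}
    [Module.Finite A M] [Module.Projective A M]
    (hg : IsExtension φ g) {k : ℕ} {L : Submodule A M} (h : IsSubbundle k L) :
    IsSubbundle k (extendSub g L) := by
  have := h.projective_quotient
  obtain ⟨_, _⟩ := h.finite_projective
  exact ⟨(hg.mapQuot_extendSub L).projective, fun p => by
    rw [(hg.restrictSub_extendSub L).rankAtStalk_eq, h.rank_eq]⟩

variable {X : CSpace}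

/-- An `A`-point of the Grassmann bundle `Gr_X(k, E)` of rank `k` subbundles of `E`: a point `x`
of `X` together with a rank `k` subbundle of `E` at `x`. -/
structure GrPoint (k : ℕ) (E : VectBundle X) (A : CommAlgCat.{0} ℂ) where
  base : X.obj A
  sub : Submodule A (E.fib base)
  isSubbundle : IsSubbundle k sub

/-- The image of a point of a Grassmann bundle under a homomorphism of algebras. -/
def GrPoint.map {k : ℕ} {E : VectBundle X} {A B : CommAlgCat.{0} ℂ} (f : A ⟶ B)
    (p : GrPoint k E A) : GrPoint k E B where
  base := X.map f p.base
  sub := extendSub (E.tr f rfl) p.sub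
  isSubbundle := p.isSubbundle.extend (E.isExtension f rfl)

theorem GrPoint.map_eq {k : ℕ} {E : VectBundle X} {A B : CommAlgCat.{0} ℂ} (f : A ⟶ B)
    (p : GrPoint k E A) (q : GrPoint k E B) (h : X.map f p.base = q.base)
    (hs : extendSub (E.tr f h) p.sub = q.sub) : p.map f = q := by
  obtain ⟨y, S, hS⟩ := q
  obtain rfl : X.map f p.base = y := h
  obtain rfl : extendSub (E.tr f rfl) p.sub = S := hs
  rfl

theorem GrPoint.sub_eq {k : ℕ} {E : VectBundle X} {A B : CommAlgCat.{0} ℂ} {f : A ⟶ B}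
    {p : GrPoint k E A} {q : GrPoint k E B} (h : p.map f = q) :
    q.sub = extendSub (E.tr f (congrArg GrPoint.base h)) p.sub := by
  subst h
  rfl

theorem GrPoint.base_eq {k : ℕ} {E : VectBundle X} {A B : CommAlgCat.{0} ℂ} {f : A ⟶ B}
    {p : GrPoint k E A} {q : GrPoint k E B} (h : p.map f = q) : X.map f p.base = q.base :=
  congrArg GrPoint.base h

theorem GrPoint.tr_mem {k : ℕ} {E : VectBundle X} {A B : CommAlgCat.{0} ℂ} {f : A ⟶ B}
    {p : GrPoint k E A} {q : GrPoint k E B} (h : p.map f = q) :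
    ∀ v ∈ p.sub, E.tr f (GrPoint.base_eq h) v ∈ q.sub := by
  subst h
  exact fun v hv => mem_extendSub _ hv

/-- The Grassmann bundle `Gr_X(k, E)`. -/
def grassmannBundle (k : ℕ) (E : VectBundle X) : CSpace where
  obj A := GrPoint k E A
  map f := ↾(GrPoint.map f)
  map_id A := by
    ext p
    refine GrPoint.map_eq _ p p (by simp) ?_
    have : ∀ v, E.tr (𝟙 A) (by simp) v = v := E.tr_id (x := p.base) (by simp)
    have h2 : (E.tr (𝟙 A) (by simp) : E.fib p.base → E.fib p.base) '' p.sub = p.sub := by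
      ext v
      exact ⟨fun ⟨w, hw, e⟩ => by rw [← e, this]; exact hw, fun hv => ⟨v, hv, this v⟩⟩
    rw [extendSub, h2]
    exact Submodule.span_eq p.sub
  map_comp {A B C} f g := by
    ext p
    have hb : X.map (f ≫ g) p.base = X.map g (X.map f p.base) := by simp
    refine GrPoint.map_eq _ p ((p.map f).map g) hb ?_
    have := E.tr_comp f g (x := p.base) rfl rfl hb
    change extendSub (E.tr (f ≫ g) hb) p.sub =
      extendSub (E.tr g (rfl : X.map g (X.map f p.base) = _)) (extendSub (E.tr f rfl) p.sub)
    refine le_antisymm (Submodule.span_le.2 ?_) (Submodule.span_le.2 ?_)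
    · rintro _ ⟨v, hv, rfl⟩
      rw [this]
      exact mem_extendSub _ (mem_extendSub _ hv)
    · rintro _ ⟨v, hv, rfl⟩
      change v ∈ Submodule.span B _ at hv
      induction hv using Submodule.span_induction with
      | mem _ h =>
        obtain ⟨w, hw, rfl⟩ := h
        exact Submodule.subset_span ⟨w, hw, this w⟩
      | zero => rw [map_zero]; exact zero_mem _
      | add a b _ _ ha hb =>
        rw [map_add]
        exact add_mem ha hb
      | smul s a _ ha =>
        rw [LinearMap.map_smulₛₗ]
        exact Submodule.smul_mem _ _ ha

/-- The tautological subbundle on `Gr_X(k, E)`. -/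
def tautSub (k : ℕ) (E : VectBundle X) : VectBundle (grassmannBundle k E) where
  fib {A} (p : GrPoint k E A) := p.sub
  addCommGroup {A} (p : GrPoint k E A) := inferInstanceAs (AddCommGroup p.sub)
  module {A} (p : GrPoint k E A) := inferInstanceAs (Module A p.sub)
  finite {A} (p : GrPoint k E A) := p.isSubbundle.finite_projective.1
  projective {A} (p : GrPoint k E A) := p.isSubbundle.finite_projective.2
  tr {A B} f {p q} (h : GrPoint.map f p = q) := restrictSub (E.tr f (GrPoint.base_eq h))
    (GrPoint.tr_mem h)
  tr_id h v := Subtype.ext (E.tr_id _ _)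
  tr_comp {_ _ _} f g {_ _ _} h h' h'' v := Subtype.ext (E.tr_comp f g _ _ _ _)
  isExtension {A B} f {p q} (h : GrPoint.map f p = q) := by
    subst h
    have := p.isSubbundle.projective_quotient
    exact (E.isExtension f _).restrictSub_extendSub p.sub

/-- The tautological quotient bundle on `Gr_X(k, E)`. -/
def tautQuot (k : ℕ) (E : VectBundle X) : VectBundle (grassmannBundle k E) where
  fib {A} (p : GrPoint k E A) := E.fib p.base ⧸ p.sub
  addCommGroup {A} (p : GrPoint k E A) := inferInstanceAs (AddCommGroup (_ ⧸ p.sub))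
  module {A} (p : GrPoint k E A) := inferInstanceAs (Module A (_ ⧸ p.sub))
  finite {A} (p : GrPoint k E A) := inferInstanceAs (Module.Finite A (_ ⧸ p.sub))
  projective {A} (p : GrPoint k E A) := p.isSubbundle.projective_quotient
  tr {A B} f {p q} (h : GrPoint.map f p = q) := mapQuot (E.tr f (GrPoint.base_eq h))
    (GrPoint.tr_mem h)
  tr_id {A p} h v := by
    obtain ⟨v, rfl⟩ := Submodule.Quotient.mk_surjective _ v
    exact congrArg Submodule.Quotient.mk (E.tr_id _ v)
  tr_comp {_ _ _} f g {_ _ _} h h' h'' v := by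
    obtain ⟨v, rfl⟩ := Submodule.Quotient.mk_surjective _ v
    exact congrArg Submodule.Quotient.mk (E.tr_comp f g _ _ _ v)
  isExtension {A B} f {p q} (h : GrPoint.map f p = q) := by
    subst h
    exact (E.isExtension f _).mapQuot_extendSub p.sub

/-! ### Grassmannians and two-step flag varieties -/

/-- The point `Spec ℂ`. -/
def pt : CSpace := (Functor.const _).obj PUnit

/-- The Grassmannian `Gr(k, n)` of `k`-dimensional subspaces of `ℂⁿ`. -/
abbrev Gr (k n : ℕ) : CSpace := grassmannBundle k (VectBundle.trivial pt n)

/-- The tautological subbundle `𝒰` on `Gr(k, n)`, of rank `k`. -/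
abbrev tautU (k n : ℕ) : VectBundle (Gr k n) := tautSub k (VectBundle.trivial pt n)

/-- The tautological quotient bundle `𝒬` on `Gr(k, n)`, of rank `n - k`. -/
abbrev tautQ (k n : ℕ) : VectBundle (Gr k n) := tautQuot k (VectBundle.trivial pt n)

/-- The line bundle `𝒪(-1) = det 𝒰` on `Gr(k, n)`, dual to the Plücker line bundle `𝒪(1)`. -/
abbrev grO (k n : ℕ) : VectBundle (Gr k n) := (tautU k n).exterior k

/-- The two-step flag variety `Fl(k₁, k₂, n)` of subspaces `V₁ ⊆ V₂ ⊆ ℂⁿ` of dimensions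
`k₁` and `k₂`. -/
def Fl (k₁ k₂ n : ℕ) : CSpace where
  obj A := {p : GrPoint k₁ (VectBundle.trivial pt n) A × GrPoint k₂ (VectBundle.trivial pt n) A //
    (p.1.sub : Submodule A (Fin n → A)) ≤ p.2.sub}
  map f := ↾fun p => ⟨(p.1.1.map f, p.1.2.map f), Submodule.span_mono (Set.image_mono p.2)⟩
  map_id A := by
    refine ConcreteCategory.hom_ext _ _ fun p => ?_
    have h₁ : p.1.1.map (𝟙 A) = p.1.1 := types_congr_hom ((Gr k₁ n).map_id A) p.1.1
    have h₂ : p.1.2.map (𝟙 A) = p.1.2 := types_congr_hom ((Gr k₂ n).map_id A) p.1.2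
    exact Subtype.ext (Prod.ext h₁ h₂)
  map_comp f g := by
    refine ConcreteCategory.hom_ext _ _ fun p => ?_
    have h₁ : p.1.1.map (f ≫ g) = (p.1.1.map f).map g :=
      types_congr_hom ((Gr k₁ n).map_comp f g) p.1.1
    have h₂ : p.1.2.map (f ≫ g) = (p.1.2.map f).map g :=
      types_congr_hom ((Gr k₂ n).map_comp f g) p.1.2
    exact Subtype.ext (Prod.ext h₁ h₂)

/-- The projection `π₁ : Fl(k₁, k₂, n) ⟶ Gr(k₁, n)`. -/
def flProj₁ (k₁ k₂ n : ℕ) : Fl k₁ k₂ n ⟶ Gr k₁ n where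
  app A := ↾fun p => p.1.1

/-- The projection `π₂ : Fl(k₁, k₂, n) ⟶ Gr(k₂, n)`. -/
def flProj₂ (k₁ k₂ n : ℕ) : Fl k₁ k₂ n ⟶ Gr k₂ n where
  app A := ↾fun p => p.1.2

/-- `𝒰₁`, the pullback of the tautological subbundle of `Gr(k₁, n)` to `Fl(k₁, k₂, n)`. -/
abbrev flU₁ (k₁ k₂ n : ℕ) : VectBundle (Fl k₁ k₂ n) := (tautU k₁ n).pullback (flProj₁ k₁ k₂ n)

/-- `𝒬₂`, the pullback of the tautological quotient bundle of `Gr(k₂, n)` to `Fl(k₁, k₂, n)`. -/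
abbrev flQ₂ (k₁ k₂ n : ℕ) : VectBundle (Fl k₁ k₂ n) := (tautQ k₂ n).pullback (flProj₂ k₁ k₂ n)

end

/-
The columns of an invertible matrix span a flag, so the sections of `𝒰₁^∨` and, after passing to the
inverse transpose, those of `𝒬₂` yield regular functions on `GL_n` that scale with one column `o`
and are invariant under the column operations that preserve the flag and the column `o`. Let `f` be
such a function, invariant under adding multiples of column `i` to column `j`. Along the opposite
operations, `f` is a polynomial in the parameter `t` and also, up to a factor `t` when `i = o`, in
`t⁻¹`; so it is constant if `i ≠ o` and of degree at most `1` if `i = o`. Hence `f` and its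
composites with column swaps transform linearly under elementary matrices, and `f` is a linear form
in the column `o`. This gives `H⁰(𝒰₁^∨) = (ℂⁿ)^∨` and `H⁰(𝒬₂) = ℂⁿ`.

The section of `𝒬₂` given by a vector `v` vanishes where `v ∈ V₂`; then `V₂ = ⟨v⟩ ⊕ W` with `W` in a
fixed complement of `v`, and `V₁ ⊂ W ⊕ 𝒪` is arbitrary. The section of `𝒰₁^∨` given by a linear form
`l` vanishes where `V₁ ⊂ ker l`; then `V₂ / V₁ ⊂ ℂⁿ / V₁ = ker l / V₁ ⊕ 𝒪` is arbitrary, and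
tensoring with the line bundle `𝒪(-1)` does not change the Grassmann bundle.
-/

open Matrix

noncomputable section

/-! ### Regular functions on general linear groups -/

section Matrices

variable {ι : Type} [DecidableEq ι] {A B : Type} [CommRing A] [CommRing B]

theorem map_transvection (φ : A →+* B) (i j : ι) (c : A) :
    (transvection i j c).map φ = transvection i j (φ c) := by
  simp only [transvection, Matrix.map_add _ (map_add φ), Matrix.map_one _ (map_zero φ) (map_one φ),
    Matrix.map_single]

variable [Fintype ι]

theorem transvection_mul_transvection_neg {i j : ι} (h : i ≠ j) {t s : A} (hts : t * s = 1) :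
    transvection j i t * transvection i j (-s) = transvection i j s * swap A i j *
      diagonal (Function.update (Function.update 1 i t) j (-s)) := by
  have hst : s * t = 1 := by rw [mul_comm, hts]
  ext k l
  rw [mul_diagonal]
  obtain rfl | hj := eq_or_ne l j
  · rw [mul_swap_apply_right, Function.update_self, mul_transvection_apply_same]
    by_cases hk : k = i <;> by_cases hk' : k = l <;> simp_all [transvection, one_apply, eq_comm]
  rw [mul_transvection_apply_of_ne _ _ _ _ hj, Function.update_of_ne hj]
  obtain rfl | hi := eq_or_ne l i
  · rw [mul_swap_apply_left, Function.update_self]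
    by_cases hk : k = l <;> by_cases hk' : k = j <;> simp_all [transvection, one_apply, eq_comm]
  · simp [mul_swap_of_ne hi hj, transvection, one_apply, hi, hi.symm, hj.symm]

theorem swap_mul_eq_submatrix (M : Matrix ι ι A) (o k : ι) :
    swap A o k * M = M.submatrix (Equiv.swap o k) id :=
  PEquiv.toMatrix_toPEquiv_mul _ _

theorem mul_swap_eq_submatrix (M : Matrix ι ι A) (o k : ι) :
    M * swap A o k = M.submatrix id (Equiv.swap o k) :=
  (PEquiv.mul_toMatrix_toPEquiv _ _).trans (by rw [Equiv.symm_swap])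

theorem diagonal_mul_swap (d : ι → A) (o k : ι) :
    diagonal d * swap A o k = swap A o k * diagonal (d ∘ Equiv.swap o k) := by
  rw [swap_mul_eq_submatrix, mul_swap_eq_submatrix]
  ext a b
  simp [diagonal_apply, Equiv.swap_apply_eq_iff]

theorem transvection_mul_swap (i j o k : ι) (c : A) :
    transvection i j c * swap A o k =
      swap A o k * transvection (Equiv.swap o k i) (Equiv.swap o k j) c := by
  rw [swap_mul_eq_submatrix, mul_swap_eq_submatrix]
  ext a b
  simp [transvection, one_apply, single_apply, Equiv.swap_apply_eq_iff]

theorem swap_mul_swap {o i j : ι} (hjo : j ≠ o) (hij : i ≠ j) :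
    swap A o j * swap A o i = swap A o i * swap A i j := by
  have h : Equiv.swap o i * Equiv.swap o j = Equiv.swap i j * Equiv.swap o i := by
    rw [Equiv.mul_swap_eq_swap_mul, Equiv.swap_apply_left,
      Equiv.swap_apply_of_ne_of_ne hjo hij.symm]
  simp only [swap, ← permMatrix_mul, h]

end Matrices

open Polynomial in
theorem coeff_toLaurent_natCast {R : Type} [CommRing R] (p : R[X]) (n : ℕ) :
    (toLaurent p).coeff n = p.coeff n := by
  rw [LaurentPolynomial.coeff_toLaurent]
  exact Finsupp.mapDomain_apply Nat.cast_injective _ _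

open Polynomial LaurentPolynomial in
theorem coeff_eq_of_toLaurent_eq {R : Type} [CommRing R] {p q : R[X]} {e : ℕ}
    (h : toLaurent p = T e * invert (toLaurent q)) (n : ℕ) :
    p.coeff n = if n ≤ e then q.coeff (e - n) else 0 := by
  have hz : p.coeff n = (toLaurent q).coeff (e - n) := by
    rw [← coeff_toLaurent_natCast, h, T, AddMonoidAlgebra.coeff_single_mul_apply, one_mul,
      invert_apply]
    congr 1
    ring
  rw [hz]
  split_ifs with hn
  · rw [← Nat.cast_sub hn, coeff_toLaurent_natCast]
  · rw [coeff_toLaurent]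
    exact Finsupp.mapDomain_of_notMem_range _ _ (by rintro ⟨m, hm⟩; simp at hm; omega)

/-- A regular function on the group scheme `GL_ι` over `ℂ`, given by its values on the invertible
matrices over all commutative `ℂ`-algebras. -/
structure GLFunction (ι : Type) [Fintype ι] [DecidableEq ι] where
  toFun : ∀ (A : Type) [CommRing A] [Algebra ℂ A], GL ι A → A
  natural : ∀ {A B : Type} [CommRing A] [Algebra ℂ A] [CommRing B] [Algebra ℂ B] (φ : A →ₐ[ℂ] B)
    (g : GL ι A), toFun B (GeneralLinearGroup.map φ.toRingHom g) = φ (toFun A g)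

theorem exists_mul_of_isUnit_det {ι A : Type} [Fintype ι] [DecidableEq ι] [CommRing A] (g : GL ι A)
    {q : Matrix ι ι A} (h : IsUnit q.det) : ∃ g' : GL ι A, g'.1 = g.1 * q :=
  ⟨g * GeneralLinearGroup.mk'' q h, rfl⟩

theorem exists_mul_transvection {ι A : Type} [Fintype ι] [DecidableEq ι] [CommRing A] (g : GL ι A)
    {i j : ι} (h : i ≠ j) (c : A) : ∃ g' : GL ι A, g'.1 = g.1 * transvection i j c :=
  exists_mul_of_isUnit_det g (by simp [h])

namespace GLFunction

variable {ι : Type} [Fintype ι] [DecidableEq ι]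

/-- `f` is unchanged when a multiple of the column `i` is added to the column `j`. -/
def ColInvariant (f : GLFunction ι) (i j : ι) : Prop :=
  ∀ (A : Type) [CommRing A] [Algebra ℂ A] (g g' : GL ι A) (c : A),
    g'.1 = g.1 * transvection i j c → f.toFun A g' = f.toFun A g

/-- Scaling the columns scales `f` by the factor of the column `o`. -/
def ScalesAt (f : GLFunction ι) (o : ι) : Prop :=
  ∀ (A : Type) [CommRing A] [Algebra ℂ A] (g g' : GL ι A) (d : ι → A),
    g'.1 = g.1 * diagonal d → f.toFun A g' = d o * f.toFun A g

theorem natural_of_map_eq (f : GLFunction ι) {A B : Type} [CommRing A] [Algebra ℂ A] [CommRing B]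
    [Algebra ℂ B] (φ : A →ₐ[ℂ] B) (g : GL ι A) (g' : GL ι B) (h : g'.1 = g.1.map φ) :
    f.toFun B g' = φ (f.toFun A g) := by
  rw [← f.natural φ g]
  exact congrArg (f.toFun B) (Units.ext h)

variable {f : GLFunction ι} {o : ι}

theorem toFun_mul_transvection_of_mul_eq_one {i j : ι} (hij : i ≠ j) (hjo : j ≠ o)
    (hs : f.ScalesAt o) (h : f.ColInvariant i j) {L : Type} [CommRing L] [Algebra ℂ L] {t s : L}
    (hts : t * s = 1) {g g₁ g₂ : GL ι L} (hg₁ : g₁.1 = g.1 * transvection j i t)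
    (hg₂ : g₂.1 = g.1 * (transvection i j s * swap L i j)) :
    f.toFun L g₁ = (if i = o then t else 1) * f.toFun L g₂ := by
  obtain ⟨g₃, hg₃⟩ := exists_mul_transvection g₁ hij (-s)
  have hd : g₃.1 = g₂.1 * diagonal (Function.update (Function.update 1 i t) j (-s)) := by
    rw [hg₃, hg₁, hg₂, mul_assoc, transvection_mul_transvection_neg hij hts, ← mul_assoc]
  rw [← h L g₁ g₃ _ hg₃, hs L g₂ g₃ _ hd, Function.update_of_ne hjo.symm]
  simp only [Function.update_apply, Pi.one_apply, eq_comm]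

open Polynomial LaurentPolynomial in
/-- The function `t ↦ f (g * transvection j i t)` on the affine line is regular at infinity up to a
factor `t`, since `f` is invariant under the opposite transvections. -/
theorem toFun_mul_transvection_X {i j : ι} (hij : i ≠ j) (hjo : j ≠ o) (hs : f.ScalesAt o)
    (h : f.ColInvariant i j) {e : ℕ} (he : e = if i = o then 1 else 0) {R : Type} [CommRing R]
    [Algebra ℂ R] (g : GL ι R) {g₁ g₂ : GL ι R[X]}
    (hg₁ : g₁.1 = g.1.map Polynomial.C * transvection j i X)
    (hg₂ : g₂.1 = g.1.map Polynomial.C * (transvection i j X * swap R[X] i j)) :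
    toLaurent (f.toFun R[X] g₁) = T e * invert (toLaurent (f.toFun R[X] g₂)) := by
  let α : R[X] →ₐ[ℂ] R[T;T⁻¹] := toLaurentAlg.restrictScalars ℂ
  let β : R[X] →ₐ[ℂ] R[T;T⁻¹] := ((invert (R := R)).toAlgHom.restrictScalars ℂ).comp α
  have hT : (T 1 : R[T;T⁻¹]) * T (-1) = 1 := by rw [← T_add, add_neg_cancel, T_zero]
  have hα : (GeneralLinearGroup.map α.toRingHom g₁).1 =
      g.1.map LaurentPolynomial.C * transvection j i (T 1) := by
    change g₁.1.map α.toRingHom = _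
    rw [hg₁, Matrix.map_mul, Matrix.map_map, map_transvection]
    exact congrArg₂ (· * ·) (Matrix.ext fun k l => toLaurent_C _)
      (congrArg (transvection j i) toLaurent_X)
  have hβ : (GeneralLinearGroup.map β.toRingHom g₂).1 =
      g.1.map LaurentPolynomial.C * (transvection i j (T (-1)) * swap R[T;T⁻¹] i j) := by
    change g₂.1.map β.toRingHom = _
    rw [hg₂, Matrix.map_mul, Matrix.map_map, Matrix.map_mul, map_transvection, map_swap]
    refine congrArg₂ (· * ·) (Matrix.ext fun k l => ?_) (congrArg (transvection i j · * _) ?_)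
    · exact (congrArg invert (toLaurent_C _)).trans (invert_C _)
    · exact (congrArg invert toLaurent_X).trans (invert_T 1)
  obtain ⟨g₀, hg₀⟩ : ∃ g₀ : GL ι R[T;T⁻¹], g₀.1 = g.1.map LaurentPolynomial.C :=
    ⟨GeneralLinearGroup.map LaurentPolynomial.C g, rfl⟩
  have := toFun_mul_transvection_of_mul_eq_one hij hjo hs h hT (hg₀ ▸ hα) (hg₀ ▸ hβ)
  rw [f.natural, f.natural] at this
  rw [he, Nat.cast_ite, apply_ite T, Nat.cast_one, Nat.cast_zero, T_zero]
  exact this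

open Polynomial in
theorem toFun_eq_eval (f : GLFunction ι) {R : Type} [CommRing R] [Algebra ℂ R] (r : R)
    {g : GL ι R} {g' : GL ι R[X]} (h : g.1 = g'.1.map (evalRingHom r)) :
    f.toFun R g = (f.toFun R[X] g').eval r := by
  rw [f.natural_of_map_eq ((aeval r).restrictScalars ℂ) g' g, AlgHom.restrictScalars_apply,
    coe_aeval_eq_eval]
  rw [h, AlgHom.coe_restrictScalars', coe_aeval_eq_eval, coe_evalRingHom]

open Polynomial in
theorem toFun_mul_transvection {i j : ι} (hij : i ≠ j) (hjo : j ≠ o) (hs : f.ScalesAt o)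
    (h : f.ColInvariant i j) {R : Type} [CommRing R] [Algebra ℂ R] (g : GL ι R) {g' : GL ι R}
    {c : R} (hg' : g'.1 = g.1 * transvection j i c) : f.toFun R g' = f.toFun R g +
      if i = o then c * f.toFun R (g * GeneralLinearGroup.swap R i j) else 0 := by
  obtain ⟨g₀, hg₀⟩ : ∃ g₀ : GL ι R[X], g₀.1 = g.1.map C := ⟨GeneralLinearGroup.map C g, rfl⟩
  obtain ⟨g₁, hg₁⟩ := exists_mul_transvection g₀ hij.symm X
  obtain ⟨g₂, hg₂⟩ := exists_mul_of_isUnit_det g₀ (q := transvection i j X * swap R[X] i j)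
    (by simpa [hij] using (Matrix.isUnit_iff_isUnit_det _).1 (GeneralLinearGroup.swap _ i j).isUnit)
  rw [hg₀] at hg₁ hg₂
  have hcoeff := coeff_eq_of_toLaurent_eq (toFun_mul_transvection_X hij hjo hs h rfl g hg₁ hg₂)
  have hC (r : R) : (g.1.map C).map (evalRingHom r) = g.1 := by ext; simp
  have hp (r : R) {g'' : GL ι R} (hr : g''.1 = g.1 * transvection j i r) :
      f.toFun R g'' = (f.toFun _ g₁).eval r :=
    f.toFun_eq_eval r (by
      rw [hr, hg₁, Matrix.map_mul, hC, map_transvection, coe_evalRingHom, eval_X])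
  have hq : f.toFun R (g * GeneralLinearGroup.swap R i j) = (f.toFun _ g₂).coeff 0 := by
    rw [coeff_zero_eq_eval_zero]
    refine f.toFun_eq_eval 0 ?_
    rw [hg₂, Matrix.map_mul, hC, Matrix.map_mul, map_transvection, map_swap, coe_evalRingHom,
      eval_X, transvection_zero, one_mul]
    rfl
  rw [hp c hg', hp 0 (by rw [transvection_zero, mul_one]), hq]
  split_ifs with hi
  · have hdeg : (f.toFun _ g₁).natDegree ≤ 1 :=
      natDegree_le_iff_coeff_eq_zero.2 fun n hn => by
        rw [hcoeff n, if_pos hi, if_neg hn.not_ge]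
    rw [eq_X_add_C_of_natDegree_le_one hdeg, hcoeff 1, if_pos hi, if_pos le_rfl, Nat.sub_self]
    simp only [eval_add, eval_mul, eval_C, eval_X]
    ring
  · have hdeg : (f.toFun _ g₁).natDegree ≤ 0 :=
      natDegree_le_iff_coeff_eq_zero.2 fun n hn => by
        rw [hcoeff n, if_neg hi, if_neg hn.not_ge]
    rw [eq_C_of_natDegree_le_zero hdeg, eval_C, eval_C, add_zero]

/-- The sections of the line bundle `𝒪(1)` on the projective space of lines `[g_o]` are the
functions `f` of this kind. -/
structure IsSemiinvariant (f : GLFunction ι) (o : ι) : Prop where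
  scalesAt : f.ScalesAt o
  colInvariant : ∀ i j, i ≠ j → j ≠ o → f.ColInvariant i j

theorem ColInvariant.symm {i j : ι} (hij : i ≠ j) (hio : i ≠ o) (hjo : j ≠ o) (hs : f.ScalesAt o)
    (h : f.ColInvariant i j) : f.ColInvariant j i := fun A _ _ g g' c hg => by
  rw [toFun_mul_transvection hij hjo hs h g hg, if_neg hio, add_zero]

theorem IsSemiinvariant.of_forall_or (hs : f.ScalesAt o)
    (h : ∀ i j, i ≠ j → j ≠ o → f.ColInvariant i j ∨ i ≠ o ∧ f.ColInvariant j i) :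
    f.IsSemiinvariant o :=
  ⟨hs, fun i j hij hj => (h i j hij hj).elim id fun ⟨hi, h'⟩ => h'.symm hij.symm hj hi hs⟩

namespace IsSemiinvariant

variable (hf : f.IsSemiinvariant o)
include hf

theorem toFun_mul_swap {A : Type} [CommRing A] [Algebra ℂ A] (g : GL ι A) {i j : ι} (hij : i ≠ j)
    (hi : i ≠ o) (hj : j ≠ o) :
    f.toFun A (g * GeneralLinearGroup.swap A i j) = f.toFun A g := by
  obtain ⟨g₀, hg₀⟩ := exists_mul_transvection g hij (-1)
  obtain ⟨g₁, hg₁⟩ := exists_mul_transvection g₀ hij.symm 1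
  have hg₂ : (g * GeneralLinearGroup.swap A i j).1 =
      g₀.1 * (transvection i j 1 * swap A i j) := by
    rw [← mul_assoc, hg₀, mul_assoc g.1, transvection_mul_transvection_same _ _ hij,
      neg_add_cancel, transvection_zero, mul_one]
    rfl
  have h := toFun_mul_transvection_of_mul_eq_one hij hj hf.scalesAt (hf.colInvariant i j hij hj)
    (mul_one 1) hg₁ hg₂
  rw [if_neg hi, one_mul] at h
  rw [← h, hf.colInvariant j i hij.symm hi A g₀ g₁ _ hg₁, hf.colInvariant i j hij hj A g g₀ _ hg₀]

theorem toFun_mul_swap_mul_swap {A : Type} [CommRing A] [Algebra ℂ A] (g : GL ι A) {i j : ι}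
    (hij : i ≠ j) : f.toFun A (g * GeneralLinearGroup.swap A o j *
      GeneralLinearGroup.swap A o (Equiv.swap o j i)) =
      f.toFun A (g * GeneralLinearGroup.swap A o i) := by
  rw [mul_assoc]
  obtain rfl | hi := eq_or_ne i o
  · have h : GeneralLinearGroup.swap A i j * GeneralLinearGroup.swap A i j =
        GeneralLinearGroup.swap A i i :=
      Units.ext ((swap_mul_self i j).trans (by simp [swap]))
    rw [Equiv.swap_apply_left, h]
  rw [Equiv.swap_apply_of_ne_of_ne hi hij]
  obtain rfl | hj := eq_or_ne j o
  · have h : GeneralLinearGroup.swap A j j = 1 := Units.ext (by simp [swap])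
    rw [h, one_mul]
  · have h : GeneralLinearGroup.swap A o j * GeneralLinearGroup.swap A o i =
        GeneralLinearGroup.swap A o i * GeneralLinearGroup.swap A i j :=
      Units.ext (swap_mul_swap hj hij)
    rw [h, ← mul_assoc, hf.toFun_mul_swap _ hij hi hj]

theorem toFun_swap_of_eq_mul_transvection {A : Type} [CommRing A] [Algebra ℂ A] {g g' : GL ι A}
    {i j : ι} (hij : i ≠ j) {c : A} (h : g'.1 = g.1 * transvection i j c) (k : ι) :
    f.toFun A (g' * GeneralLinearGroup.swap A o k) =
      f.toFun A (g * GeneralLinearGroup.swap A o k) +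
        if k = j then c * f.toFun A (g * GeneralLinearGroup.swap A o i) else 0 := by
  have hσ : (g' * GeneralLinearGroup.swap A o k).1 = (g * GeneralLinearGroup.swap A o k).1 *
      transvection (Equiv.swap o k i) (Equiv.swap o k j) c := by
    change g'.1 * swap A o k = g.1 * swap A o k * _
    rw [h, mul_assoc, transvection_mul_swap, mul_assoc]
  have hij' : Equiv.swap o k i ≠ Equiv.swap o k j := (Equiv.swap o k).injective.ne hij
  obtain rfl | hk := eq_or_ne k j
  · rw [Equiv.swap_apply_right] at hσ hij'
    rw [toFun_mul_transvection hij'.symm hij' hf.scalesAt (hf.colInvariant _ _ hij'.symm hij') _ hσ,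
      if_pos rfl, if_pos rfl, hf.toFun_mul_swap_mul_swap g hij]
  · rw [if_neg hk, add_zero]
    refine hf.colInvariant _ _ hij' (fun hj => hk ?_) A _ _ c hσ
    rw [Equiv.swap_apply_eq_iff, Equiv.swap_apply_left] at hj
    exact hj.symm

theorem toFun_swap_of_eq_mul {K : Type} [Field K] [Algebra ℂ K] {q : Matrix ι ι K} (hq : q.det ≠ 0)
    {g g' : GL ι K} (h : g'.1 = g.1 * q) (k : ι) :
    f.toFun K (g' * GeneralLinearGroup.swap K o k) =
      ∑ m, q m k * f.toFun K (g * GeneralLinearGroup.swap K o m) := by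
  refine diagonal_transvection_induction_of_det_ne_zero (fun q => ∀ (g g' : GL ι K) (k : ι),
    g'.1 = g.1 * q → f.toFun K (g' * GeneralLinearGroup.swap K o k) =
      ∑ m, q m k * f.toFun K (g * GeneralLinearGroup.swap K o m)) q hq
    (fun d _ g g' k h => ?_) (fun t g g' k h => ?_) (fun q₁ q₂ h₁ _ ih₁ ih₂ g g' k h => ?_) g g' k h
  · have hd : (g' * GeneralLinearGroup.swap K o k).1 = (g * GeneralLinearGroup.swap K o k).1 *
        diagonal (d ∘ Equiv.swap o k) := by
      change g'.1 * swap K o k = g.1 * swap K o k * _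
      rw [h, mul_assoc, diagonal_mul_swap, mul_assoc]
    rw [hf.scalesAt K _ _ _ hd]
    simp [diagonal_apply]
  · rw [hf.toFun_swap_of_eq_mul_transvection t.hij h]
    simp [TransvectionStruct.toMatrix, transvection, add_mul, Finset.sum_add_distrib, one_apply,
      single_apply, ite_and, eq_comm (a := k)]
  · obtain ⟨g'', hg''⟩ := exists_mul_of_isUnit_det g h₁.isUnit
    rw [← mul_assoc, ← hg''] at h
    simp only [ih₂ _ _ _ h, ih₁ _ _ _ hg'', mul_apply, Finset.mul_sum, Finset.sum_mul]
    rw [Finset.sum_comm]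
    simp only [mul_assoc, mul_left_comm]

theorem toFun_eq_sum_of_field {K : Type} [Field K] [Algebra ℂ K] (g : GL ι K) :
    f.toFun K g =
      ∑ k, algebraMap ℂ K (f.toFun ℂ (GeneralLinearGroup.swap ℂ o k)) * g.1 k o := by
  have hdet : g.1.det ≠ 0 := ((Matrix.isUnit_iff_isUnit_det _).1 g.isUnit).ne_zero
  have h := hf.toFun_swap_of_eq_mul hdet (g := 1) (one_mul _).symm o
  have hswap : GeneralLinearGroup.swap K o o = 1 := Units.ext (by simp [swap])
  rw [hswap, mul_one] at h
  refine h.trans (Finset.sum_congr rfl fun k _ => ?_)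
  rw [one_mul, mul_comm, f.natural_of_map_eq (Algebra.ofId ℂ K) (GeneralLinearGroup.swap ℂ o k) _
    (map_swap (algebraMap ℂ K) o k).symm]
  rfl

end IsSemiinvariant

theorem exists_universal_matrix (ι : Type) [Fintype ι] [DecidableEq ι] :
    ∃ (L : Type) (_ : CommRing L) (_ : IsDomain L) (_ : Algebra ℂ L) (G : GL ι L),
      ∀ (A : Type) [CommRing A] [Algebra ℂ A] (g : GL ι A), ∃ ψ : L →ₐ[ℂ] A, g.1 = G.1.map ψ := by
  let S := MvPolynomial (ι × ι) ℂ
  let d : S := (mvPolynomialX ι ι ℂ).det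
  have hle : Submonoid.powers d ≤ nonZeroDivisors S :=
    powers_le_nonZeroDivisors_of_noZeroDivisors (det_mvPolynomialX_ne_zero ι ℂ)
  let X : Matrix ι ι (Localization.Away d) := (mvPolynomialX ι ι ℂ).map (algebraMap S _)
  have hX : IsUnit X.det := by
    change IsUnit ((algebraMap S (Localization.Away d)).mapMatrix (mvPolynomialX ι ι ℂ)).det
    rw [← RingHom.map_det]
    exact IsLocalization.Away.algebraMap_isUnit d
  refine ⟨Localization.Away d, inferInstance, IsLocalization.isDomain_localization hle,
    inferInstance, GeneralLinearGroup.mk'' X hX, fun A _ _ g => ?_⟩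
  let φ : S →ₐ[ℂ] A := MvPolynomial.aeval fun p => g.1 p.1 p.2
  have hφ (p : ι × ι) : φ (MvPolynomial.X p) = g.1 p.1 p.2 := MvPolynomial.aeval_X _ p
  have hd : φ d = g.1.det := by
    rw [AlgHom.map_det]
    exact congrArg det (Matrix.ext fun i j => hφ (i, j))
  have hunit : IsUnit (φ d) := hd ▸ (Matrix.isUnit_iff_isUnit_det _).1 g.isUnit
  refine ⟨IsLocalization.liftAlgHom (M := Submonoid.powers d) (f := φ) ?_, ?_⟩
  · rintro ⟨_, n, rfl⟩
    simpa only [map_pow] using hunit.pow n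
  · ext i j
    exact ((IsLocalization.lift_eq _ _).trans (hφ (i, j))).symm

theorem ext_of_field {f f' : GLFunction ι}
    (h : ∀ (K : Type) [Field K] [Algebra ℂ K] (g : GL ι K), f.toFun K g = f'.toFun K g)
    (A : Type) [CommRing A] [Algebra ℂ A] (g : GL ι A) : f.toFun A g = f'.toFun A g := by
  obtain ⟨L, _, _, _, G, hG⟩ := exists_universal_matrix ι
  obtain ⟨ψ, hψ⟩ := hG A g
  have hL : f.toFun L G = f'.toFun L G := by
    let i : L →ₐ[ℂ] FractionRing L := IsScalarTower.toAlgHom ℂ L (FractionRing L)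
    refine IsFractionRing.injective L (FractionRing L) (?_ : i _ = i _)
    rw [← f.natural, ← f'.natural, h]
  rw [f.natural_of_map_eq ψ G g hψ, f'.natural_of_map_eq ψ G g hψ, hL]

/-- The linear form with the complex coefficients `l` in the column `o`. -/
def linear (l : ι → ℂ) (o : ι) : GLFunction ι where
  toFun A _ _ g := ∑ k, algebraMap ℂ A (l k) * g.1 k o
  natural φ g := by
    rw [map_sum]
    refine Finset.sum_congr rfl fun k _ => ?_
    rw [map_mul, AlgHom.commutes]
    rfl

theorem IsSemiinvariant.exists_toFun_eq_sum (hf : f.IsSemiinvariant o) :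
    ∃ l : ι → ℂ, ∀ (A : Type) [CommRing A] [Algebra ℂ A] (g : GL ι A),
      f.toFun A g = ∑ k, algebraMap ℂ A (l k) * g.1 k o :=
  ⟨fun k => f.toFun ℂ (GeneralLinearGroup.swap ℂ o k),
    ext_of_field (f' := linear _ o) fun _ _ _ g => hf.toFun_eq_sum_of_field g⟩

end GLFunction

/-! ### Flags spanned by columns -/

theorem extendSub_span {A B : Type} [CommRing A] [CommRing B] {φ : A →+* B} {M N : Type}
    [AddCommGroup M] [Module A M] [AddCommGroup N] [Module B N] (g : M →ₛₗ[φ] N) (S : Set M) :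
    extendSub g (Submodule.span A S) = Submodule.span B (g '' S) := by
  refine le_antisymm (Submodule.span_le.2 ?_) (Submodule.span_mono (Set.image_mono
    Submodule.subset_span))
  rintro _ ⟨x, hx, rfl⟩
  induction hx using Submodule.span_induction with
  | mem _ h => exact Submodule.subset_span ⟨_, h, rfl⟩
  | zero => rw [map_zero]; exact zero_mem _
  | add a b _ _ ha hb => rw [map_add]; exact add_mem ha hb
  | smul s a _ ha => rw [LinearMap.map_smulₛₗ]; exact Submodule.smul_mem _ _ ha

theorem projective_quotient_of_retraction {A M : Type} [CommRing A] [AddCommGroup M] [Module A M]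
    [Module.Projective A M] {L : Submodule A M} (p : M →ₗ[A] L) (hp : ∀ x : L, p x = x) :
    Module.Projective A (M ⧸ L) := by
  refine Module.Projective.of_split (L.liftQ (LinearMap.id - L.subtype ∘ₗ p) ?_) L.mkQ ?_
  · intro x hx
    simpa [sub_eq_zero] using (congrArg Subtype.val (hp ⟨x, hx⟩)).symm
  · ext x
    simp

theorem isSubbundle_span_basis {A M ι : Type} [CommRing A] [AddCommGroup M] [Module A M]
    (b : Module.Basis ι A M) (J : Set ι) [Finite J] :
    IsSubbundle (Nat.card J) (Submodule.span A (b '' J)) := by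
  have := Module.Projective.of_basis b
  refine ⟨projective_quotient_of_retraction _ (Submodule.projectionOnto_apply_left
    (b.linearIndependent.isCompl_span_image b.span_eq (isCompl_compl (x := J)))), fun P => ?_⟩
  have := P.nontrivial
  have := Fintype.ofFinite J
  have hli : LinearIndependent A fun i : J => b i :=
    b.linearIndependent.comp _ Subtype.val_injective
  rw [Set.image_eq_range]
  have := Module.Free.of_basis (Module.Basis.span hli)
  rw [Module.rankAtStalk_eq_finrank_of_free, Pi.natCast_apply,
    Module.finrank_eq_card_basis (Module.Basis.span hli), Nat.card_eq_fintype_card, Nat.cast_id]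

section ColSpan

variable {ι A : Type} [Fintype ι] [DecidableEq ι] [CommRing A]

/-- The span of the columns of `g` with indices in `J`. -/
def colSpan (J : Set ι) (g : GL ι A) : Submodule A (ι → A) :=
  Submodule.span A (g.1.col '' J)

theorem col_mem_colSpan {J : Set ι} (g : GL ι A) {j : ι} (hj : j ∈ J) :
    g.1.col j ∈ colSpan J g :=
  Submodule.subset_span ⟨j, hj, rfl⟩

theorem isSubbundle_colSpan (J : Set ι) (g : GL ι A) : IsSubbundle (Nat.card J) (colSpan J g) := by
  let b := (Pi.basisFun A ι).map (toLin'OfInv g.inv_mul g.mul_inv)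
  have hb : g.1.col = b := by ext; simp [b]
  rw [colSpan, hb]
  exact isSubbundle_span_basis b J

theorem colSpan_map {B : Type} [CommRing B] (J : Set ι) (φ : A →+* B) (g : GL ι A) :
    colSpan J (GeneralLinearGroup.map φ g) =
      Submodule.span B ((fun v : ι → A => φ ∘ v) '' (g.1.col '' J)) := by
  rw [Set.image_image]
  rfl

theorem col_eq_smul_of_eq_mul_diagonal {g g' : GL ι A} {d : ι → A} (hg : g'.1 = g.1 * diagonal d)
    (j : ι) : g'.1.col j = d j • g.1.col j := by
  ext
  simp [hg, mul_comm]

theorem col_eq_add_of_eq_mul_transvection {g g' : GL ι A} {i j : ι} {c : A}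
    (hg : g'.1 = g.1 * transvection i j c) : g'.1.col j = g.1.col j + c • g.1.col i := by
  ext
  simp [hg, mul_transvection_apply_same]

theorem col_eq_of_eq_mul_transvection {g g' : GL ι A} {i j l : ι} {c : A}
    (hg : g'.1 = g.1 * transvection i j c) (hl : l ≠ j) : g'.1.col l = g.1.col l := by
  ext
  simp [hg, mul_transvection_apply_of_ne, hl]

theorem isUnit_of_eq_mul_diagonal {d : ι → A} {g g' : GL ι A} (hg : g'.1 = g.1 * diagonal d)
    (i : ι) : IsUnit (d i) := by
  have h : IsUnit (diagonal d) := (Units.isUnit_units_mul g _).1 (hg ▸ g'.isUnit)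
  exact Pi.isUnit_iff.1 (isUnit_diagonal.1 h) i

theorem colSpan_eq_of_eq_mul_diagonal (J : Set ι) {d : ι → A} {g g' : GL ι A}
    (hg : g'.1 = g.1 * diagonal d) : colSpan J g' = colSpan J g := by
  refine le_antisymm (Submodule.span_le.2 ?_) (Submodule.span_le.2 ?_)
  · rintro _ ⟨l, hl, rfl⟩
    rw [col_eq_smul_of_eq_mul_diagonal hg]
    exact Submodule.smul_mem _ _ (col_mem_colSpan g hl)
  · rintro _ ⟨l, hl, rfl⟩
    refine (Submodule.smul_mem_iff_of_isUnit _ (isUnit_of_eq_mul_diagonal hg l)).1 ?_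
    rw [← col_eq_smul_of_eq_mul_diagonal hg]
    exact col_mem_colSpan g' hl

theorem colSpan_le_of_eq_mul_transvection {J : Set ι} {i j : ι} (h : j ∈ J → i ∈ J) {c : A}
    {g g' : GL ι A} (hg : g'.1 = g.1 * transvection i j c) : colSpan J g' ≤ colSpan J g := by
  refine Submodule.span_le.2 ?_
  rintro _ ⟨l, hl, rfl⟩
  obtain rfl | hlj := eq_or_ne l j
  · rw [col_eq_add_of_eq_mul_transvection hg]
    exact add_mem (col_mem_colSpan g hl) (Submodule.smul_mem _ _ (col_mem_colSpan g (h hl)))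
  · rw [col_eq_of_eq_mul_transvection hg hlj]
    exact col_mem_colSpan g hl

theorem colSpan_eq_of_eq_mul_transvection {J : Set ι} {i j : ι} (hij : i ≠ j)
    (h : j ∈ J → i ∈ J) {c : A} {g g' : GL ι A} (hg : g'.1 = g.1 * transvection i j c) :
    colSpan J g' = colSpan J g := by
  refine le_antisymm (colSpan_le_of_eq_mul_transvection h hg)
    (colSpan_le_of_eq_mul_transvection h (c := -c) ?_)
  rw [hg, mul_assoc, transvection_mul_transvection_same _ _ hij, add_neg_cancel,
    transvection_zero, mul_one]

theorem exists_col_eq (o i : ι) (v : ι → A) (h : IsUnit (v i)) : ∃ g : GL ι A, g.1.col o = v := by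
  let M : Matrix ι ι A := (updateCol 1 o (v ∘ Equiv.swap i o)).submatrix (Equiv.swap i o) id
  have hM : IsUnit M.det := by
    rw [det_permute, ← cramer_apply, cramer_one]
    exact ((Equiv.Perm.sign (Equiv.swap i o)).isUnit.map (Int.castRingHom A)).mul (by simpa using h)
  exact ⟨GeneralLinearGroup.mk'' M hM, funext fun k =>
    (updateCol_self (i := Equiv.swap i o k)).trans (by simp)⟩

end ColSpan

section FlagPoints

variable {n k k₁ k₂ : ℕ}

theorem natCard_setOf_val_lt (hk : k ≤ n) : Nat.card {j : Fin n | j.1 < k} = k := by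
  simp [Fin.card_filter_val_lt, hk]

/-- The point of `Gr(k, n)` given by the first `k` columns of an invertible matrix. -/
def grPoint (hk : k ≤ n) {A : CommAlgCat.{0} ℂ} (g : GL (Fin n) A) :
    GrPoint k (VectBundle.trivial pt n) A where
  base := PUnit.unit
  sub := colSpan {j | j.1 < k} g
  isSubbundle := by
    have := isSubbundle_colSpan {j | j.1 < k} g
    rwa [natCard_setOf_val_lt hk] at this

/-- The flag given by the columns of an invertible matrix. -/
def flPoint (h₁ : k₁ ≤ k₂) (h₂ : k₂ ≤ n) {A : CommAlgCat.{0} ℂ} (g : GL (Fin n) A) :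
    (Fl k₁ k₂ n).obj A :=
  ⟨(grPoint (h₁.trans h₂) g, grPoint h₂ g),
    Submodule.span_mono (Set.image_mono fun _ h => lt_of_lt_of_le h h₁)⟩

theorem GrPoint.ext_of_trivial {A : CommAlgCat.{0} ℂ} {p q : GrPoint k (VectBundle.trivial pt n) A}
    (h : (p.sub : Submodule A (Fin n → A)) = q.sub) : p = q := by
  obtain ⟨⟨⟩, S, hS⟩ := p
  obtain ⟨⟨⟩, T, hT⟩ := q
  obtain rfl : S = T := h
  rfl

/-- The first subspace of a flag. -/
abbrev flSub₁ {A : CommAlgCat.{0} ℂ} (x : (Fl k₁ k₂ n).obj A) : Submodule A (Fin n → A) :=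
  x.1.1.sub

/-- The second subspace of a flag. -/
abbrev flSub₂ {A : CommAlgCat.{0} ℂ} (x : (Fl k₁ k₂ n).obj A) : Submodule A (Fin n → A) :=
  x.1.2.sub

theorem Fl.ext {A : CommAlgCat.{0} ℂ} {x y : (Fl k₁ k₂ n).obj A} (h₁ : flSub₁ x = flSub₁ y)
    (h₂ : flSub₂ x = flSub₂ y) : x = y :=
  Subtype.ext (Prod.ext (GrPoint.ext_of_trivial h₁) (GrPoint.ext_of_trivial h₂))

theorem grPoint_map (hk : k ≤ n) {A B : CommAlgCat.{0} ℂ} (f : A ⟶ B) (g : GL (Fin n) A) :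
    (grPoint hk g).map f = grPoint hk (GeneralLinearGroup.map f.hom.toRingHom g) := by
  refine GrPoint.ext_of_trivial ((extendSub_span _ _).trans ?_)
  change _ = colSpan {j | j.1 < k} (GeneralLinearGroup.map f.hom.toRingHom g)
  rw [colSpan_map]
  rfl

theorem flPoint_map (h₁ : k₁ ≤ k₂) (h₂ : k₂ ≤ n) {A B : CommAlgCat.{0} ℂ} (f : A ⟶ B)
    (g : GL (Fin n) A) :
    (Fl k₁ k₂ n).map f (flPoint h₁ h₂ g) =
      flPoint h₁ h₂ (GeneralLinearGroup.map f.hom.toRingHom g) :=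
  Subtype.ext (Prod.ext (grPoint_map (h₁.trans h₂) f g) (grPoint_map h₂ f g))

theorem flPoint_eq_of_eq_mul_diagonal (h₁ : k₁ ≤ k₂) (h₂ : k₂ ≤ n) {A : CommAlgCat.{0} ℂ}
    {g g' : GL (Fin n) A} {d : Fin n → A} (hg : g'.1 = g.1 * diagonal d) :
    flPoint h₁ h₂ g' = flPoint h₁ h₂ g :=
  Fl.ext (colSpan_eq_of_eq_mul_diagonal _ hg) (colSpan_eq_of_eq_mul_diagonal _ hg)

theorem flPoint_eq_of_eq_mul_transvection (h₁ : k₁ ≤ k₂) (h₂ : k₂ ≤ n) {A : CommAlgCat.{0} ℂ}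
    {g g' : GL (Fin n) A} {i j : Fin n} {c : A} (hij : i ≠ j) (hj₁ : j.1 < k₁ → i.1 < k₁)
    (hj₂ : j.1 < k₂ → i.1 < k₂) (hg : g'.1 = g.1 * transvection i j c) :
    flPoint h₁ h₂ g' = flPoint h₁ h₂ g :=
  Fl.ext (colSpan_eq_of_eq_mul_transvection hij hj₁ hg)
    (colSpan_eq_of_eq_mul_transvection hij hj₂ hg)

end FlagPoints

section IsLocalRing

variable {A M : Type} [CommRing A] [IsLocalRing A] [AddCommGroup M] [Module A M] [Module.Finite A M]

theorem IsSubbundle.exists_basis [Module.Projective A M] {k : ℕ} {L : Submodule A M}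
    (h : IsSubbundle k L) : Nonempty (Module.Basis (Fin k) A L) := by
  obtain ⟨_, _⟩ := h.finite_projective
  have : Module.Free A L := Module.free_of_flat_of_isLocalRing
  have hr : Module.finrank A L = k := by
    have h₁ := h.rank_eq (IsLocalRing.closedPoint A)
    rw [Module.rankAtStalk_eq_finrank_of_free] at h₁
    simpa using h₁
  exact ⟨Module.finBasisOfFinrankEq A L hr⟩

theorem exists_basis_extending {k m : ℕ} {L : Submodule A M} [Module.Projective A (M ⧸ L)]
    (b : Module.Basis (Fin k) A L) (b' : Module.Basis (Fin m) A M) :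
    ∃ (h : k ≤ m) (c : Module.Basis (Fin m) A M), ∀ i, c (Fin.castLE h i) = b i := by
  have : Module.Free A (M ⧸ L) := Module.free_of_flat_of_isLocalRing
  let q := Module.finBasis A (M ⧸ L)
  let c := (b.sumQuot q).reindex finSumFinEquiv
  have hm : k + Module.finrank A (M ⧸ L) = m := by
    simpa using (Module.finrank_eq_card_basis c).symm.trans (Module.finrank_eq_card_basis b')
  refine ⟨by omega, c.reindex (finCongr hm), fun i => ?_⟩
  have : (finCongr hm).symm (Fin.castLE (by omega) i) = Fin.castAdd _ i := by
    ext; simp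
  rw [Module.Basis.reindex_apply, this]
  simp [c]

end IsLocalRing

theorem span_image_val_lt_eq {A M : Type} [CommRing A] [AddCommGroup M] [Module A M] {k m : ℕ}
    (h : k ≤ m) {L : Submodule A M} (b : Module.Basis (Fin k) A L) (c : Fin m → M)
    (hc : ∀ i, c (Fin.castLE h i) = b i) : Submodule.span A (c '' {j | j.1 < k}) = L := by
  have : c '' {j | j.1 < k} = L.subtype '' Set.range b := by
    rw [← Fin.range_castLE h, ← Set.range_comp, ← Set.range_comp]
    exact congrArg Set.range (funext hc)
  rw [this, Submodule.span_image, b.span_eq, Submodule.map_top, Submodule.range_subtype]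

theorem exists_flPoint_eq {n k₁ k₂ : ℕ} (h₁ : k₁ ≤ k₂) (h₂ : k₂ ≤ n) {A : CommAlgCat.{0} ℂ}
    [IsLocalRing A] (x : (Fl k₁ k₂ n).obj A) : ∃ g : GL (Fin n) A, flPoint h₁ h₂ g = x := by
  have hV₁ : IsSubbundle k₁ (flSub₁ x) := x.1.1.isSubbundle
  have hV₂ : IsSubbundle k₂ (flSub₂ x) := x.1.2.isSubbundle
  have := hV₁.projective_quotient
  have := hV₂.projective_quotient
  obtain ⟨_, _⟩ := hV₂.finite_projective
  obtain ⟨b₁⟩ := hV₁.exists_basis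
  obtain ⟨b₂⟩ := hV₂.exists_basis
  let e : (flSub₁ x).submoduleOf (flSub₂ x) ≃ₗ[A] flSub₁ x := Submodule.submoduleOfEquivOfLe x.2
  have : Module.Projective A (flSub₂ x ⧸ (flSub₁ x).submoduleOf (flSub₂ x)) := by
    obtain ⟨p, hp⟩ := exists_retraction (flSub₁ x)
    refine projective_quotient_of_retraction (e.symm ∘ₗ p ∘ₗ (flSub₂ x).subtype) fun v => ?_
    exact e.symm_apply_eq.2 (hp (e v))
  obtain ⟨_, c₂, hc₂⟩ := exists_basis_extending (b₁.map e.symm) b₂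
  obtain ⟨_, c, hc⟩ := exists_basis_extending c₂ (Pi.basisFun A (Fin n))
  let g : GL (Fin n) A := ⟨(Pi.basisFun A (Fin n)).toMatrix c, c.toMatrix (Pi.basisFun A (Fin n)),
    Module.Basis.toMatrix_mul_toMatrix_flip _ _, Module.Basis.toMatrix_mul_toMatrix_flip _ _⟩
  refine ⟨g, Fl.ext (span_image_val_lt_eq (h₁.trans h₂) b₁ g.1.col fun i => ?_)
    (span_image_val_lt_eq h₂ c₂ g.1.col hc)⟩
  exact (hc (Fin.castLE h₁ i)).trans (congrArg Subtype.val (hc₂ i))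

/-! ### Global sections -/

namespace VectBundle

variable {X : CSpace} {E : VectBundle X}

theorem eq_zero_of_forall_isLocalRing {A : CommAlgCat.{0} ℂ} {x : X.obj A} (v : E.fib x)
    (h : ∀ (B : CommAlgCat.{0} ℂ), IsLocalRing B → ∀ f : A ⟶ B,
      E.tr f (y := X.map f x) rfl v = 0) : v = 0 := by
  have hdual : ∀ (B : CommAlgCat.{0} ℂ) (f : A ⟶ B), E.tr f (y := X.map f x) rfl v = 0 →
      ∀ c : Module.Dual A (E.fib x), f.hom (c v) = 0 := by
    intro B f hB c
    have := dualExt_apply (E.isExtension f (x := x) rfl) c v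
    rw [hB, map_zero] at this
    exact this.symm
  obtain ⟨r, m, c, -, hm, -, -⟩ := (E.isExtension (𝟙 A) (x := x) rfl).exists_frame
  rw [← hm v]
  refine Finset.sum_eq_zero fun i _ => ?_
  have : c i v = 0 := eq_zero_of_localization _ fun J hJ =>
    hdual (CommAlgCat.of ℂ (Localization.AtPrime J))
      (CommAlgCat.ofHom (IsScalarTower.toAlgHom ℂ A (Localization.AtPrime J)))
      (h _ (inferInstanceAs (IsLocalRing (Localization.AtPrime J))) _) (c i)
  rw [this, zero_smul]

theorem globalSections_ext {s t : E.globalSections}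
    (h : ∀ (A : CommAlgCat.{0} ℂ), IsLocalRing A → ∀ x : X.obj A, s.1 A x = t.1 A x) : s = t := by
  refine Subtype.ext (funext fun A => funext fun x => ?_)
  rw [← sub_eq_zero]
  refine eq_zero_of_forall_isLocalRing _ fun B hB f => ?_
  rw [map_sub, s.2 A B f x _ rfl, t.2 A B f x _ rfl, h B hB, sub_self]

end VectBundle

theorem HoldsForGeneral.of_linearEquiv {V : Type*} [AddCommGroup V] [Module ℂ V] {n : ℕ}
    (e : (Fin n → ℂ) ≃ₗ[ℂ] V) {P : V → Prop} (i : Fin n) (h : ∀ l, l i ≠ 0 → P (e l)) :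
    HoldsForGeneral P := by
  refine ⟨n, Module.Basis.ofEquivFun e.symm, MvPolynomial.X i, MvPolynomial.X_ne_zero i,
    fun v hv => ?_⟩
  have := h (e.symm v) (by simpa using hv)
  simpa using this

section ConstVec

variable {ι A : Type} [CommRing A] [Algebra ℂ A]

/-- The vector of `A^ι` with the complex coordinates `v`. -/
def constVec (v : ι → ℂ) (A : Type) [CommRing A] [Algebra ℂ A] : ι → A :=
  algebraMap ℂ A ∘ v

theorem constVec_add (v w : ι → ℂ) : constVec (v + w) A = constVec v A + constVec w A :=
  funext fun _ => map_add _ _ _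

theorem constVec_smul (c : ℂ) (v : ι → ℂ) : constVec (c • v) A = algebraMap ℂ A c • constVec v A :=
  funext fun _ => map_mul _ _ _

theorem comp_constVec {B : Type} [CommRing B] [Algebra ℂ B] (φ : A →ₐ[ℂ] B) (v : ι → ℂ) :
    φ ∘ constVec v A = constVec v B :=
  funext fun i => φ.commutes (v i)

theorem map_dotProduct_constVec [Fintype ι] {B : Type} [CommRing B] [Algebra ℂ B] (φ : A →ₐ[ℂ] B)
    (v : ι → A) (l : ι → ℂ) : φ (v ⬝ᵥ constVec l A) = (φ ∘ v) ⬝ᵥ constVec l B := by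
  rw [← comp_constVec φ]
  exact RingHom.map_dotProduct φ.toRingHom _ _

theorem eq_zero_of_forall_col_dotProduct_eq_zero [Fintype ι] [DecidableEq ι] {l : ι → ℂ} (o : ι)
    (h : ∀ g : GL ι ℂ, g.1.col o ⬝ᵥ constVec l ℂ = 0) : l = 0 := by
  funext i
  obtain ⟨g, hg⟩ := exists_col_eq (A := ℂ) o i (Pi.single i 1) (by simp)
  simpa [hg, constVec] using h g

end ConstVec

/-- A family of linear forms on the spans of the columns of invertible matrices with indices in
`J`, depending regularly on the matrix. -/
structure ColForm {ι : Type} [Fintype ι] [DecidableEq ι] (J : Set ι) where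
  form : ∀ (A : Type) [CommRing A] [Algebra ℂ A] (g : GL ι A), Module.Dual A (colSpan J g)
  natural : ∀ {A B : Type} [CommRing A] [Algebra ℂ A] [CommRing B] [Algebra ℂ B] (φ : A →ₐ[ℂ] B)
    (g : GL ι A) (v : colSpan J g) (w : colSpan J (GeneralLinearGroup.map φ.toRingHom g)),
    w.1 = φ ∘ v.1 → form B _ w = φ (form A g v)

namespace ColForm

variable {ι : Type} [Fintype ι] [DecidableEq ι] {J : Set ι} (F : ColForm J)

/-- The forms of the family at two matrices coincide. -/
def Agree {A : Type} [CommRing A] [Algebra ℂ A] (g g' : GL ι A) : Prop :=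
  ∀ (v : colSpan J g) (v' : colSpan J g'), v'.1 = v.1 → F.form A g' v' = F.form A g v

/-- The value of the form at the column `o`. -/
def colFunction {o : ι} (ho : o ∈ J) : GLFunction ι where
  toFun A _ _ g := F.form A g ⟨g.1.col o, col_mem_colSpan g ho⟩
  natural φ g := F.natural φ g _ _ rfl

variable {F}

theorem colFunction_scalesAt {o : ι} (ho : o ∈ J)
    (hF : ∀ (A : Type) [CommRing A] [Algebra ℂ A] (g g' : GL ι A) (d : ι → A),
      g'.1 = g.1 * diagonal d → F.Agree g g') : (F.colFunction ho).ScalesAt o := by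
  intro A _ _ g g' d hg
  exact (hF A g g' d hg (d o • ⟨g.1.col o, col_mem_colSpan g ho⟩) _
    (col_eq_smul_of_eq_mul_diagonal hg o)).trans (map_smul _ _ _)

theorem colFunction_colInvariant {o i j : ι} (ho : o ∈ J) (hj : j ≠ o)
    (hF : ∀ (A : Type) [CommRing A] [Algebra ℂ A] (g g' : GL ι A) (c : A),
      g'.1 = g.1 * transvection i j c → F.Agree g g') : (F.colFunction ho).ColInvariant i j :=
  fun A _ _ g g' c hg => hF A g g' c hg _ _ (col_eq_of_eq_mul_transvection hg hj.symm)

theorem form_col_eq_dotProduct {o : ι} (ho : o ∈ J) {l : ι → ℂ}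
    (hl : ∀ (A : Type) [CommRing A] [Algebra ℂ A] (g : GL ι A),
      (F.colFunction ho).toFun A g = g.1.col o ⬝ᵥ constVec l A)
    (hF : ∀ (A : Type) [CommRing A] [Algebra ℂ A] (g g' : GL ι A) (j : ι) (c : A), j ∈ J → j ≠ o →
      g'.1 = g.1 * transvection j o c → F.Agree g g')
    {A : Type} [CommRing A] [Algebra ℂ A] (g : GL ι A) (j : ι) (hj : j ∈ J) :
    F.form A g ⟨g.1.col j, col_mem_colSpan g hj⟩ = g.1.col j ⬝ᵥ constVec l A := by
  obtain rfl | hjo := eq_or_ne j o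
  · exact hl A g
  obtain ⟨g', hg'⟩ := exists_mul_transvection g hjo 1
  have hcol : g'.1.col o = g.1.col o + g.1.col j := by
    rw [col_eq_add_of_eq_mul_transvection hg', one_smul]
  have h := hF A g g' j 1 hj hjo hg'
    (⟨g.1.col o, col_mem_colSpan g ho⟩ + ⟨g.1.col j, col_mem_colSpan g hj⟩)
    ⟨g'.1.col o, col_mem_colSpan g' ho⟩ hcol
  have hg := hl A g'
  rw [hcol, add_dotProduct, ← hl A g] at hg
  rw [map_add] at h
  exact add_left_cancel (h.symm.trans hg)

theorem exists_form_eq_dotProduct {o : ι} (ho : o ∈ J) {r : ι → ι → Prop}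
    (hr : ∀ i j, r i j ∨ r j i) (hJ : ∀ i ∈ J, ∀ j, r i j)
    (hdiag : ∀ (A : Type) [CommRing A] [Algebra ℂ A] (g g' : GL ι A) (d : ι → A),
      g'.1 = g.1 * diagonal d → F.Agree g g')
    (htrans : ∀ (A : Type) [CommRing A] [Algebra ℂ A] (g g' : GL ι A) (i j : ι) (c : A),
      i ≠ j → r i j → g'.1 = g.1 * transvection i j c → F.Agree g g') :
    ∃ l : ι → ℂ, ∀ (A : Type) [CommRing A] [Algebra ℂ A] (g : GL ι A) (v : colSpan J g),
      F.form A g v = v.1 ⬝ᵥ constVec l A := by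
  have hinv : ∀ i j, i ≠ j → j ≠ o → r i j → (F.colFunction ho).ColInvariant i j :=
    fun i j hij hj h => colFunction_colInvariant ho hj fun A _ _ g g' c =>
      htrans A g g' i j c hij h
  have hsemi : (F.colFunction ho).IsSemiinvariant o :=
    .of_forall_or (colFunction_scalesAt ho hdiag) fun i j hij hj => by
      obtain rfl | hi := eq_or_ne i o
      · exact .inl (hinv i j hij hj (hJ i ho j))
      · exact (hr i j).imp (hinv i j hij hj) fun h => ⟨hi, hinv j i hij.symm hi h⟩
  obtain ⟨l, hl⟩ := hsemi.exists_toFun_eq_sum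
  have hcol : ∀ (A : Type) [CommRing A] [Algebra ℂ A] (g : GL ι A) (j : ι) (hj : j ∈ J),
      F.form A g ⟨g.1.col j, col_mem_colSpan g hj⟩ = g.1.col j ⬝ᵥ constVec l A :=
    fun A _ _ => form_col_eq_dotProduct ho (fun A _ _ g => (hl A g).trans (dotProduct_comm _ _))
      fun A _ _ g g' j c hj hjo => htrans A g g' j o c hjo (hJ j hj o)
  refine ⟨l, fun A _ _ g => LinearMap.congr_fun
    (g := (dotProductBilin A A).flip (constVec l A) ∘ₗ (colSpan J g).subtype)
    (LinearMap.ext_on Submodule.span_span_coe_preimage ?_)⟩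
  rintro ⟨_, _⟩ ⟨j, hj, rfl⟩
  exact hcol A g j hj

end ColForm

/-- The linear form on `A^ι` with the complex coefficients `l`. -/
abbrev linForm {ι : Type} [Fintype ι] (l : ι → ℂ) (A : Type) [CommRing A] [Algebra ℂ A] :
    Module.Dual A (ι → A) :=
  (dotProductBilin A A).flip (constVec l A)

section SectionsU

variable {n k₁ k₂ : ℕ}

/-- The section of `𝒰₁^∨` which restricts a linear form on `ℂⁿ` to the first subspaces of flags. -/
def secU (k₁ k₂ n : ℕ) : (Fin n → ℂ) →ₗ[ℂ] (flU₁ k₁ k₂ n).dual.globalSections where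
  toFun l := ⟨fun A x => linForm l A ∘ₗ (flSub₁ x).subtype, by
    intro A B f x y h
    refine ((flU₁ k₁ k₂ n).isExtension f h).hom_ext fun v => ?_
    exact (dualExt_apply ((flU₁ k₁ k₂ n).isExtension f h)
      (linForm l A ∘ₗ (flSub₁ x).subtype) v).trans (map_dotProduct_constVec f.hom v.1 l)⟩
  map_add' l l' := Subtype.ext (funext fun A => funext fun x => LinearMap.ext fun v =>
    (congrArg (v.1 ⬝ᵥ ·) (constVec_add l l')).trans (dotProduct_add v.1 _ _))
  map_smul' c l := Subtype.ext (funext fun A => funext fun x => LinearMap.ext fun v =>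
    (congrArg (v.1 ⬝ᵥ ·) (constVec_smul c l)).trans (dotProduct_smul _ v.1 _))

/-- A section of `𝒰₁^∨` as a linear form on the first subspace of a flag. -/
def formU (s : (flU₁ k₁ k₂ n).dual.globalSections) {A : CommAlgCat.{0} ℂ}
    (x : (Fl k₁ k₂ n).obj A) : Module.Dual A (flSub₁ x) :=
  s.1 A x

theorem formU_congr (s : (flU₁ k₁ k₂ n).dual.globalSections) {A : CommAlgCat.{0} ℂ}
    {x y : (Fl k₁ k₂ n).obj A} (h : x = y) {v : flSub₁ x} {w : flSub₁ y} (hvw : v.1 = w.1) :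
    formU s x v = formU s y w := by
  subst h
  exact congrArg _ (Subtype.ext hvw)

theorem formU_map (s : (flU₁ k₁ k₂ n).dual.globalSections) {A B : CommAlgCat.{0} ℂ} (f : A ⟶ B)
    {x : (Fl k₁ k₂ n).obj A} {y : (Fl k₁ k₂ n).obj B} (h : (Fl k₁ k₂ n).map f x = y)
    {v : flSub₁ x} {w : flSub₁ y} (hvw : w.1 = f.hom ∘ v.1) :
    formU s y w = f.hom (formU s x v) := by
  rw [formU, ← s.2 A B f x y h]
  obtain rfl : w = (flU₁ k₁ k₂ n).tr f h v := Subtype.ext hvw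
  exact dualExt_apply ((flU₁ k₁ k₂ n).isExtension f h) (s.1 A x) v

/-- A section of `𝒰₁^∨` evaluated at the flags of columns. -/
def colFormU (h₁ : k₁ ≤ k₂) (h₂ : k₂ ≤ n) (s : (flU₁ k₁ k₂ n).dual.globalSections) :
    ColForm {j : Fin n | j.1 < k₁} where
  form A _ _ g := formU s (flPoint h₁ h₂ (A := .of ℂ A) g)
  natural φ g _ _ h := formU_map s (CommAlgCat.ofHom φ) (flPoint_map h₁ h₂ (CommAlgCat.ofHom φ) g) h

theorem exists_formU_flPoint_eq (h₁ : k₁ ≤ k₂) (h₂ : k₂ ≤ n) (hk₁ : 0 < k₁)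
    (s : (flU₁ k₁ k₂ n).dual.globalSections) :
    ∃ l : Fin n → ℂ, ∀ (A : CommAlgCat.{0} ℂ) (g : GL (Fin n) A) (v : flSub₁ (flPoint h₁ h₂ g)),
      formU s (flPoint h₁ h₂ g) v = linForm l A v := by
  obtain ⟨l, hl⟩ := ColForm.exists_form_eq_dotProduct (F := colFormU h₁ h₂ s)
    (o := ⟨0, by omega⟩) hk₁ (r := fun i j => (j.1 < k₁ → i.1 < k₁) ∧ (j.1 < k₂ → i.1 < k₂))
    (fun i j => by omega) (fun i (hi : i.1 < k₁) j => by omega)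
    (fun A _ _ g g' d hg v v' h =>
      formU_congr s (flPoint_eq_of_eq_mul_diagonal (A := .of ℂ A) h₁ h₂ hg) h)
    fun A _ _ g g' i j c hij hr hg v v' h =>
      formU_congr s (flPoint_eq_of_eq_mul_transvection (A := .of ℂ A) h₁ h₂ hij hr.1 hr.2 hg) h
  exact ⟨l, fun A => hl A⟩

theorem secU_bijective (h₁ : k₁ ≤ k₂) (h₂ : k₂ ≤ n) (hk₁ : 0 < k₁) :
    Function.Bijective (secU k₁ k₂ n) := by
  constructor
  · refine (injective_iff_map_eq_zero _).2 fun l hl => ?_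
    refine eq_zero_of_forall_col_dotProduct_eq_zero ⟨0, by omega⟩ fun g => ?_
    have h : formU (secU k₁ k₂ n l) (flPoint (A := .of ℂ ℂ) h₁ h₂ g) = 0 := by
      rw [hl]; rfl
    exact LinearMap.congr_fun h ⟨_, col_mem_colSpan g hk₁⟩
  · intro s
    obtain ⟨l, hl⟩ := exists_formU_flPoint_eq h₁ h₂ hk₁ s
    refine ⟨l, VectBundle.globalSections_ext fun A _ x => ?_⟩
    obtain ⟨g, rfl⟩ := exists_flPoint_eq h₁ h₂ x
    exact (LinearMap.ext (hl A g)).symm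

end SectionsU

section Contragredient

variable {ι A : Type} [Fintype ι] [DecidableEq ι] [CommRing A]

/-- The inverse transpose of an invertible matrix. -/
def contra (h : GL ι A) : GL ι A where
  val := (h⁻¹).1ᵀ
  inv := h.1ᵀ
  val_inv := by rw [← transpose_mul, h.mul_inv, transpose_one]
  inv_val := by rw [← transpose_mul, h.inv_mul, transpose_one]

theorem contra_contra (h : GL ι A) : contra (contra h) = h :=
  Units.ext (transpose_transpose h.1)

theorem contra_map {B : Type} [CommRing B] (φ : A →+* B) (h : GL ι A) :
    contra (GeneralLinearGroup.map φ h) = GeneralLinearGroup.map φ (contra h) := by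
  ext i j
  change ((GeneralLinearGroup.map φ h)⁻¹ : GL ι B).1 j i = φ ((h⁻¹ : GL ι A).1 j i)
  rw [← map_inv]
  rfl

theorem contra_eq_mul_transpose {h h' : GL ι A} {q : Matrix ι ι A} (hh : h'.1 = h.1 * q) :
    (contra h).1 = (contra h').1 * qᵀ := by
  have h₁ : (contra h').1 * h'.1ᵀ = 1 := (contra h').mul_inv
  have h₂ : h.1ᵀ * (contra h).1 = 1 := (contra h).inv_mul
  rw [hh, transpose_mul, ← mul_assoc] at h₁
  rw [← mul_one ((contra h').1 * qᵀ), ← h₂, ← mul_assoc, h₁, one_mul]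

theorem col_dotProduct_col_contra (h : GL ι A) (i j : ι) :
    h.1.col i ⬝ᵥ (contra h).1.col j = if i = j then 1 else 0 := by
  have : h.1ᵀ * (contra h).1 = 1 := (contra h).inv_mul
  rw [← one_apply, ← this]
  rfl

theorem sum_col_dotProduct_smul_col_contra (h : GL ι A) (w : ι → A) :
    ∑ j, (h.1.col j ⬝ᵥ w) • (contra h).1.col j = w := by
  have : (contra h).1 * h.1ᵀ = 1 := (contra h).mul_inv
  conv_rhs => rw [← one_mulVec w, ← this, ← mulVec_mulVec, mulVec_eq_sum]
  exact Finset.sum_congr rfl fun _ _ => (op_smul_eq_smul _ _).symm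

theorem mem_colSpan_contra_iff {J : Set ι} {h : GL ι A} {w : ι → A} :
    w ∈ colSpan J (contra h) ↔ ∀ c ∈ colSpan Jᶜ h, c ⬝ᵥ w = 0 := by
  constructor
  · intro hw c hc
    have hle : colSpan Jᶜ h ≤ LinearMap.ker ((dotProductBilin A A).flip w) := by
      refine Submodule.span_le.2 ?_
      rintro _ ⟨j, hj, rfl⟩
      have : colSpan J (contra h) ≤ LinearMap.ker (dotProductBilin A A (h.1.col j)) := by
        refine Submodule.span_le.2 ?_
        rintro _ ⟨i, hi, rfl⟩
        exact (col_dotProduct_col_contra h j i).trans (if_neg (by rintro rfl; exact hj hi))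
      exact this hw
    exact hle hc
  · intro hw
    rw [← sum_col_dotProduct_smul_col_contra h w]
    refine Submodule.sum_mem _ fun j _ => ?_
    by_cases hj : j ∈ J
    · exact Submodule.smul_mem _ _ (col_mem_colSpan _ hj)
    · rw [hw _ (col_mem_colSpan h hj), zero_smul]
      exact zero_mem _

end Contragredient

section SectionsQ

variable {n k₁ k₂ : ℕ}

/-- The section of `𝒬₂` which reduces a vector of `ℂⁿ` modulo the second subspaces of flags. -/
def secQ (k₁ k₂ n : ℕ) : (Fin n → ℂ) →ₗ[ℂ] (flQ₂ k₁ k₂ n).globalSections where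
  toFun v := ⟨fun A x => (flSub₂ x).mkQ (constVec v A), fun _ _ f _ y _ =>
    congrArg (flSub₂ y).mkQ (comp_constVec f.hom v)⟩
  map_add' v w := Subtype.ext (funext fun _ => funext fun x =>
    (congrArg (flSub₂ x).mkQ (constVec_add v w)).trans (map_add _ _ _))
  map_smul' c v := Subtype.ext (funext fun _ => funext fun x =>
    (congrArg (flSub₂ x).mkQ (constVec_smul c v)).trans (map_smul _ _ _))

/-- A vector of `Aⁿ` representing the value of a section of `𝒬₂` at a flag. -/
def liftQ₂ (s : (flQ₂ k₁ k₂ n).globalSections) {A : CommAlgCat.{0} ℂ} (x : (Fl k₁ k₂ n).obj A) :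
    Fin n → A :=
  Quotient.out (s := Submodule.quotientRel (flSub₂ x)) (s.1 A x)

theorem mkQ_liftQ₂ (s : (flQ₂ k₁ k₂ n).globalSections) {A : CommAlgCat.{0} ℂ}
    (x : (Fl k₁ k₂ n).obj A) : (flSub₂ x).mkQ (liftQ₂ s x) = s.1 A x :=
  Quotient.out_eq' (s₁ := Submodule.quotientRel (flSub₂ x)) _

theorem mkQ_eq_of_sub_liftQ₂_mem {s : (flQ₂ k₁ k₂ n).globalSections} {A : CommAlgCat.{0} ℂ}
    {x : (Fl k₁ k₂ n).obj A} {v : Fin n → A} (h : v - liftQ₂ s x ∈ flSub₂ x) :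
    (flSub₂ x).mkQ v = s.1 A x :=
  ((Submodule.Quotient.eq _).2 h).trans (mkQ_liftQ₂ s x)

theorem liftQ₂_map_sub_mem (s : (flQ₂ k₁ k₂ n).globalSections) {A B : CommAlgCat.{0} ℂ}
    (f : A ⟶ B) {x : (Fl k₁ k₂ n).obj A} {y : (Fl k₁ k₂ n).obj B} (h : (Fl k₁ k₂ n).map f x = y) :
    liftQ₂ s y - f.hom ∘ liftQ₂ s x ∈ flSub₂ y := by
  refine (Submodule.Quotient.eq _).1 ((mkQ_liftQ₂ s y).trans ((s.2 A B f x y h).symm.trans ?_))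
  exact congrArg ((flQ₂ k₁ k₂ n).tr f h) (mkQ_liftQ₂ s x).symm

theorem flPoint_contra_map (h₁ : k₁ ≤ k₂) (h₂ : k₂ ≤ n) {A B : CommAlgCat.{0} ℂ} (f : A ⟶ B)
    (h : GL (Fin n) A) :
    (Fl k₁ k₂ n).map f (flPoint h₁ h₂ (contra h)) =
      flPoint h₁ h₂ (contra (GeneralLinearGroup.map f.hom.toRingHom h)) := by
  rw [contra_map, flPoint_map]

/-- A section of `𝒬₂` paired with the linear forms which vanish on the second subspace of a flag,
for the flags of columns of inverse transposes. -/
def colFormQ (h₁ : k₁ ≤ k₂) (h₂ : k₂ ≤ n) (s : (flQ₂ k₁ k₂ n).globalSections) :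
    ColForm {j : Fin n | j.1 < k₂}ᶜ where
  form A _ _ h := (dotProductBilin A A).flip (liftQ₂ s (flPoint h₁ h₂ (A := .of ℂ A) (contra h))) ∘ₗ
    Submodule.subtype _
  natural {A B} _ _ _ _ φ h v w hw := by
    have := mem_colSpan_contra_iff.1 (liftQ₂_map_sub_mem s (CommAlgCat.ofHom φ)
      (flPoint_contra_map h₁ h₂ (CommAlgCat.ofHom φ) h)) w.1 w.2
    rw [dotProduct_sub, sub_eq_zero] at this
    refine this.trans ?_
    rw [hw]
    exact (RingHom.map_dotProduct φ.toRingHom v.1 _).symm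

theorem exists_colFormQ_eq (h₁ : k₁ ≤ k₂) (h₂ : k₂ < n) (s : (flQ₂ k₁ k₂ n).globalSections) :
    ∃ v : Fin n → ℂ, ∀ (A : CommAlgCat.{0} ℂ) (h : GL (Fin n) A),
      ∀ c ∈ colSpan {j | j.1 < k₂}ᶜ h,
        c ⬝ᵥ liftQ₂ s (flPoint h₁ h₂.le (contra h)) = c ⬝ᵥ constVec v A := by
  have hagree : ∀ (A : Type) [CommRing A] [Algebra ℂ A] (g g' : GL (Fin n) A),
      flPoint (A := .of ℂ A) h₁ h₂.le (contra g) = flPoint h₁ h₂.le (contra g') →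
      (colFormQ h₁ h₂.le s).Agree g g' := fun A _ _ g g' h v v' hv =>
    congrArg₂ (· ⬝ᵥ ·) hv (congrArg (liftQ₂ s) h.symm)
  obtain ⟨v, hv⟩ := ColForm.exists_form_eq_dotProduct (F := colFormQ h₁ h₂.le s)
    (o := ⟨k₂, h₂⟩) (lt_irrefl k₂)
    (r := fun i j => (i.1 < k₁ → j.1 < k₁) ∧ (i.1 < k₂ → j.1 < k₂))
    (fun i j => by omega) (fun i (hi : ¬ i.1 < k₂) j => by omega)
    (fun A _ _ g g' d hg => hagree A g g' (flPoint_eq_of_eq_mul_diagonal h₁ h₂.le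
      ((contra_eq_mul_transpose hg).trans (by rw [diagonal_transpose]))))
    fun A _ _ g g' i j c hij hr hg => hagree A g g' (flPoint_eq_of_eq_mul_transvection (c := c) h₁
      h₂.le hij.symm hr.1 hr.2 ((contra_eq_mul_transpose hg).trans (by
        simp only [transvection, transpose_add, transpose_one, transpose_single])))
  exact ⟨v, fun A h c hc => hv A h ⟨c, hc⟩⟩

theorem secQ_bijective (h₁ : k₁ ≤ k₂) (h₂ : k₂ < n) : Function.Bijective (secQ k₁ k₂ n) := by
  constructor
  · refine (injective_iff_map_eq_zero _).2 fun v hv => ?_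
    refine eq_zero_of_forall_col_dotProduct_eq_zero ⟨k₂, h₂⟩ fun h => ?_
    have hmem : constVec v ℂ ∈ flSub₂ (flPoint (A := .of ℂ ℂ) h₁ h₂.le (contra h)) :=
      (Submodule.Quotient.mk_eq_zero _).1 (congrFun (congrFun (congrArg Subtype.val hv) _) _)
    exact mem_colSpan_contra_iff.1 hmem _ (col_mem_colSpan h (lt_irrefl k₂))
  · intro s
    obtain ⟨v, hv⟩ := exists_colFormQ_eq h₁ h₂ s
    refine ⟨v, VectBundle.globalSections_ext fun A _ x => ?_⟩
    obtain ⟨g, rfl⟩ := exists_flPoint_eq h₁ h₂.le x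
    rw [← contra_contra g]
    have hmem : constVec v A - liftQ₂ s (flPoint h₁ h₂.le (contra (contra g))) ∈
        colSpan {j | j.1 < k₂} (contra (contra g)) := mem_colSpan_contra_iff.2 fun c hc => by
      rw [dotProduct_sub, hv A (contra g) c hc, sub_self]
    exact mkQ_eq_of_sub_liftQ₂_mem hmem

end SectionsQ

/-! ### Tensor products with line bundles -/

section Subbundles

variable {A M N : Type} [CommRing A] [AddCommGroup M] [Module A M] [AddCommGroup N] [Module A N]

theorem rankAtStalk_map_of_injective {α : M →ₗ[A] N} (hα : Function.Injective α)
    (L : Submodule A M) : Module.rankAtStalk (R := A) (L.map α) = Module.rankAtStalk L :=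
  (Module.rankAtStalk_eq_of_equiv (Submodule.equivMapOfInjective α hα L)).symm

theorem IsSubbundle.map [Module.Projective A M] [Module.Projective A N] {k : ℕ}
    {L : Submodule A M} (h : IsSubbundle k L) (α : M →ₗ[A] N) (r : N →ₗ[A] M)
    (hr : ∀ x, r (α x) = x) : IsSubbundle k (L.map α) := by
  have hα : Function.Injective α := Function.LeftInverse.injective hr
  have := h.projective_quotient
  obtain ⟨p, hp⟩ := exists_retraction L
  refine ⟨projective_quotient_of_retraction
    ((Submodule.equivMapOfInjective α hα L : L →ₗ[A] L.map α) ∘ₗ p ∘ₗ r) ?_, fun P => ?_⟩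
  · rintro ⟨_, x, hx, rfl⟩
    refine Subtype.ext ?_
    simp only [LinearMap.comp_apply, hr, hp ⟨x, hx⟩]
    rfl
  · rw [rankAtStalk_map_of_injective hα, h.rank_eq]

theorem IsSubbundle.of_map [Module.Projective A M] {k : ℕ} {L : Submodule A M} {α : M →ₗ[A] N}
    (hα : Function.Injective α) (h : IsSubbundle k (L.map α)) : IsSubbundle k L := by
  have := h.projective_quotient
  obtain ⟨p, hp⟩ := exists_retraction (L.map α)
  let e := Submodule.equivMapOfInjective α hα L
  refine ⟨projective_quotient_of_retraction (e.symm.toLinearMap ∘ₗ p ∘ₗ α) fun x => ?_, fun P => ?_⟩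
  · have hx : p (α x) = e x := hp (e x)
    rw [LinearMap.comp_apply, LinearMap.comp_apply, hx]
    exact e.symm_apply_apply x
  · rw [← h.rank_eq P, rankAtStalk_map_of_injective hα]

theorem rankAtStalk_comap {π : M →ₗ[A] N} (hπ : Function.Surjective π) (S : Submodule A N)
    [Module.Finite A (LinearMap.ker π)] [Module.Projective A (LinearMap.ker π)]
    [Module.Finite A S] [Module.Projective A S] (p : PrimeSpectrum A) :
    Module.rankAtStalk (R := A) (S.comap π) p =
      Module.rankAtStalk (R := A) (LinearMap.ker π) p + Module.rankAtStalk (R := A) S p := by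
  let i := Submodule.inclusion (LinearMap.ker_le_comap (f := π) (p := S))
  let π' : S.comap π →ₗ[A] S := π.restrict fun _ hx => hx
  have hexact : Function.Exact i π' := by
    rintro ⟨x, hx⟩
    refine ⟨fun h => ⟨⟨x, congrArg Subtype.val h⟩, rfl⟩, ?_⟩
    rintro ⟨⟨y, hy⟩, h⟩
    obtain rfl : y = x := congrArg Subtype.val h
    exact Subtype.ext hy
  have hπ' : Function.Surjective π' := by
    rintro ⟨y, hy⟩
    obtain ⟨x, rfl⟩ := hπ y
    exact ⟨⟨x, hy⟩, rfl⟩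
  obtain ⟨σ, hσ⟩ := Module.projective_lifting_property π' LinearMap.id hπ'
  let e := (hexact.splitSurjectiveEquiv (Submodule.inclusion_injective _) ⟨σ, hσ⟩).1
  rw [Module.rankAtStalk_eq_of_equiv e, Module.rankAtStalk_prod, Pi.add_apply]

/-- The quotients by a submodule and by its preimage agree. -/
def comapQuotEquiv {π : M →ₗ[A] N} (hπ : Function.Surjective π) (S : Submodule A N) :
    (M ⧸ S.comap π) ≃ₗ[A] N ⧸ S :=
  (Submodule.quotEquivOfEq _ _ (by rw [LinearMap.ker_comp, Submodule.ker_mkQ])).trans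
    ((S.mkQ ∘ₗ π).quotKerEquivOfSurjective (S.mkQ_surjective.comp hπ))

variable [Module.Finite A M] [Module.Projective A M] [Module.Finite A N] [Module.Projective A N]
  {π : M →ₗ[A] N} {j k : ℕ} {S : Submodule A N}

theorem IsSubbundle.comap_iff (hπ : Function.Surjective π) (hk : IsSubbundle k (LinearMap.ker π)) :
    IsSubbundle (k + j) (S.comap π) ↔ IsSubbundle j S := by
  obtain ⟨_, _⟩ := hk.finite_projective
  have rank_add (hq : Module.Projective A (N ⧸ S)) (p : PrimeSpectrum A) :
      Module.rankAtStalk (R := A) (S.comap π) p = k + Module.rankAtStalk (R := A) S p := by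
    obtain ⟨r, hr⟩ := exists_retraction S
    have : Module.Finite A S := .of_surjective r fun x => ⟨x, hr x⟩
    have : Module.Projective A S := .of_split S.subtype r (LinearMap.ext hr)
    rw [rankAtStalk_comap hπ, hk.rank_eq]
  constructor
  · intro h
    have := h.projective_quotient
    have hq : Module.Projective A (N ⧸ S) := .of_equiv (comapQuotEquiv hπ S)
    exact ⟨hq, fun p => Nat.add_left_cancel ((rank_add hq p).symm.trans (h.rank_eq p))⟩
  · intro h
    have hq := h.projective_quotient
    exact ⟨.of_equiv (comapQuotEquiv hπ S).symm, fun p => by rw [rank_add hq, h.rank_eq]⟩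

end Subbundles

section BaseChange

variable {A B : Type} [CommRing A] [CommRing B] {φ : A →+* B} {M N M' N' : Type}
  [AddCommGroup M] [Module A M] [AddCommGroup N] [Module B N]
  [AddCommGroup M'] [Module A M'] [AddCommGroup N'] [Module B N'] {g : M →ₛₗ[φ] N}
  {g' : M' →ₛₗ[φ] N'}

theorem IsExtension.extendSub_top (h : IsExtension φ g) : extendSub g ⊤ = ⊤ := by
  rw [extendSub, Submodule.top_coe, Set.image_univ, h.span_eq_top]

theorem extendSub_map {α : M →ₗ[A] M'} {β : N →ₗ[B] N'} (h : ∀ x, g' (α x) = β (g x))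
    (L : Submodule A M) : extendSub g' (L.map α) = (extendSub g L).map β := by
  rw [extendSub, extendSub, Submodule.map_span, Submodule.map_coe, Set.image_image, Set.image_image]
  simp only [h]

theorem extendSub_map₂ {E E' : Type} [AddCommGroup E] [Module A E] [AddCommGroup E'] [Module B E']
    {β : M →ₗ[A] M' →ₗ[A] E} {β' : N →ₗ[B] N' →ₗ[B] E'} {gE : E →ₛₗ[φ] E'}
    (h : ∀ x y, gE (β x y) = β' (g x) (g' y)) (S : Submodule A M) (T : Submodule A M') :
    extendSub gE (Submodule.map₂ β S T) =
      Submodule.map₂ β' (extendSub g S) (extendSub g' T) := by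
  rw [Submodule.map₂_eq_span_image2, extendSub_span, extendSub, extendSub, Submodule.map₂_span_span,
    Set.image_image2, Set.image2_image_left, Set.image2_image_right]
  simp only [h]

end BaseChange

section Invertible

open TensorProduct

variable {A P N : Type} [CommRing A] [AddCommGroup P] [Module A P] [AddCommGroup N] [Module A N]

/-- The submodule `S ⊗ N` of `P ⊗ N`, for a submodule `S` of `P`. -/
def tensorSub (N : Type) [AddCommGroup N] [Module A N] (S : Submodule A P) :
    Submodule A (P ⊗[A] N) :=
  Submodule.map₂ (TensorProduct.mk A P N) S ⊤

theorem tensorSub_range {S : Type} [AddCommGroup S] [Module A S] (f : S →ₗ[A] P) :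
    tensorSub N (LinearMap.range f) = LinearMap.range (f.rTensor N) := by
  rw [LinearMap.rTensor, TensorProduct.range_map, LinearMap.range_id]
  rfl

theorem isSubbundle_tensorSub [Module.Finite A P] [Module.Projective A P] [Module.Invertible A N]
    {k : ℕ} {S : Submodule A P} (hS : IsSubbundle k S) : IsSubbundle k (tensorSub N S) := by
  have := hS.projective_quotient
  obtain ⟨_, _⟩ := hS.finite_projective
  have hrange : tensorSub N S = LinearMap.range (S.subtype.rTensor N) := by
    rw [← tensorSub_range, S.range_subtype]
  have hinj : Function.Injective (S.subtype.rTensor N) :=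
    Module.Flat.rTensor_preserves_injective_linearMap _ S.injective_subtype
  rw [hrange]
  refine ⟨.of_equiv (TensorProduct.quotientTensorEquiv N S), fun p => ?_⟩
  have hN : Module.rankAtStalk (R := A) N p = 1 := by
    simp [Module.rankAtStalk, Module.Invertible.finrank_eq_one]
  rw [← Module.rankAtStalk_eq_of_equiv (LinearEquiv.ofInjective _ hinj),
    Module.rankAtStalk_tensorProduct, Pi.mul_apply, hS.rank_eq, hN, mul_one]

theorem map_rightCancelEquiv_tensorSub_tensorSub {N' : Type} [AddCommGroup N'] [Module A N']
    (e : N ⊗[A] N' ≃ₗ[A] A) (S : Submodule A P) :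
    (tensorSub N' (tensorSub N S)).map (Module.Invertible.rightCancelEquiv P e).toLinearMap =
      S := by
  have h := congrArg LinearMap.range
    (Module.Invertible.rightCancelEquiv_comp_rTensor_comp_symm e S.subtype)
  rw [S.range_subtype, LinearMap.range_comp, LinearEquiv.range_comp, ← tensorSub_range,
    ← tensorSub_range, S.range_subtype] at h
  exact h

theorem tensorSub_injective [Module.Invertible A N] :
    Function.Injective (tensorSub N : Submodule A P → Submodule A (P ⊗[A] N)) := by
  intro S T h
  let e := (TensorProduct.comm A N (Module.Dual A N)).trans (Module.Invertible.linearEquiv A N)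
  rw [← map_rightCancelEquiv_tensorSub_tensorSub e S, h,
    map_rightCancelEquiv_tensorSub_tensorSub e T]

theorem exists_tensorSub_eq [Module.Finite A P] [Module.Projective A P] [Module.Invertible A N]
    {k : ℕ} {L : Submodule A (P ⊗[A] N)} (hL : IsSubbundle k L) :
    ∃ S : Submodule A P, IsSubbundle k S ∧ tensorSub N S = L := by
  let e := Module.Invertible.linearEquiv A N
  let e' := (TensorProduct.comm A N (Module.Dual A N)).trans e
  let c := Module.Invertible.rightCancelEquiv P e'
  let S := (tensorSub (Module.Dual A N) L).map c.toLinearMap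
  refine ⟨S, (isSubbundle_tensorSub hL).map _ c.symm.toLinearMap c.symm_apply_apply, ?_⟩
  refine tensorSub_injective (N := Module.Dual A N) ?_
  refine (Submodule.map_injective_of_injective c.injective) ?_
  exact map_rightCancelEquiv_tensorSub_tensorSub e' S

/-- Under the hypothesis the endomorphisms of `N` given by elements of `N^* ⊗ N` are the scalars
obtained by contraction, so the contraction is as bijective as `N^* ⊗ N → End N`. -/
theorem invertible_of_smul_comm [Module.Finite A N] [Module.Projective A N] [FaithfulSMul A N]
    (h : ∀ (ξ : Module.Dual A N) (x y : N), ξ x • y = ξ y • x) : Module.Invertible A N := by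
  have hom_apply (t : Module.Dual A N ⊗[A] N) (x : N) :
      dualTensorHom A N N t x = contractLeft A N t • x := by
    induction t with
    | zero => simp
    | add s t hs ht => rw [map_add, map_add, LinearMap.add_apply, hs, ht, add_smul]
    | tmul ξ y => rw [dualTensorHom_apply, contractLeft_apply, h]
  obtain ⟨hinj, hsurj⟩ := dualTensorHom_bijective (R := A) (M := N) (N := N)
  refine ⟨(injective_iff_map_eq_zero _).2 fun t ht => hinj (LinearMap.ext fun x => ?_), fun a => ?_⟩
  · rw [hom_apply, ht, zero_smul, map_zero, LinearMap.zero_apply]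
  · obtain ⟨t, ht⟩ := hsurj (a • LinearMap.id)
    refine ⟨t, FaithfulSMul.eq_of_smul_eq_smul fun x : N => ?_⟩
    rw [← hom_apply, ht, LinearMap.smul_apply, LinearMap.id_apply]

theorem smul_comm_of_invertible [Module.Invertible A N] (ξ : Module.Dual A N) (x y : N) :
    ξ x • y = ξ y • x := by
  have h := congrArg (TensorProduct.lid A N ∘ ξ.rTensor N)
    (Module.Invertible.tmul_comm (R := A) (m₁ := x) (m₂ := y))
  simpa only [Function.comp_apply, LinearMap.rTensor_tmul, TensorProduct.lid_tmul] using h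

end Invertible

section LineBundles

variable {X : CSpace} {E : VectBundle X} {A : CommAlgCat.{0} ℂ}

theorem VectBundle.invertible_of_forall_isLocalRing
    (h : ∀ (B : CommAlgCat.{0} ℂ), IsLocalRing B → ∀ y : X.obj B, Module.Invertible B (E.fib y))
    (x : X.obj A) : Module.Invertible A (E.fib x) := by
  have smul_comm (ξ : Module.Dual A (E.fib x)) (v w : E.fib x) : ξ v • w = ξ w • v := by
    rw [← sub_eq_zero]
    refine E.eq_zero_of_forall_isLocalRing _ fun B hB f => ?_
    have := h B hB (X.map f x)
    have hξ := dualExt_apply (E.isExtension f (x := x) rfl) ξ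
    rw [map_sub, LinearMap.map_smulₛₗ, LinearMap.map_smulₛₗ, ← hξ, ← hξ,
      smul_comm_of_invertible, sub_self]
  have map_eq {a b : A} (hab : ∀ v : E.fib x, a • v = b • v) (B : CommAlgCat.{0} ℂ)
      (hB : IsLocalRing B) (f : A ⟶ B) : f.hom a = f.hom b := by
    have := h B hB (X.map f x)
    have smul_eq : f.hom a • LinearMap.id = f.hom b • (LinearMap.id : Module.End B _) :=
      (E.isExtension f (x := x) rfl).hom_ext fun v =>
        ((E.tr f rfl).map_smulₛₗ a v).symm.trans
          ((congrArg _ (hab v)).trans ((E.tr f rfl).map_smulₛₗ b v))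
    exact FaithfulSMul.eq_of_smul_eq_smul (LinearMap.congr_fun smul_eq)
  have faithful : FaithfulSMul A (E.fib x) := by
    refine ⟨fun {a b} hab => sub_eq_zero.1 (eq_zero_of_localization _ fun J hJ => ?_)⟩
    rw [map_sub, sub_eq_zero]
    exact map_eq hab (CommAlgCat.of ℂ (Localization.AtPrime J))
      (inferInstanceAs (IsLocalRing (Localization.AtPrime J)))
      (CommAlgCat.ofHom (IsScalarTower.toAlgHom ℂ A (Localization.AtPrime J)))
  exact invertible_of_smul_comm smul_comm

instance grO_invertible {k m : ℕ} (x : (Gr k m).obj A) :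
    Module.Invertible A ((grO k m).fib x) := by
  refine VectBundle.invertible_of_forall_isLocalRing (fun B hB y => ?_) x
  obtain ⟨b⟩ := y.isSubbundle.exists_basis
  have : Module.Free B y.sub := .of_basis b
  have := y.isSubbundle.finite_projective.1
  have hr : Module.finrank B (⋀[B]^k y.sub) = 1 := by
    rw [exteriorPower.finrank_eq, Module.finrank_eq_card_basis b, Fintype.card_fin,
      Nat.choose_self]
  obtain ⟨e⟩ := Module.nonempty_linearEquiv_of_finrank_eq_one hr
  exact .congr e

end LineBundles

/-! ### Zero loci -/

section Splitting

variable {m : ℕ}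

/-- A splitting of `ℂ^(m + 1)` as `ℂᵐ ⊕ ℂ`, in the form of the isomorphisms it induces over all
algebras. -/
structure Splitting (m : ℕ) where
  equiv (A : CommAlgCat.{0} ℂ) : ((Fin m → A) × A) ≃ₗ[A] (Fin (m + 1) → A)
  equiv_map {A B : CommAlgCat.{0} ℂ} (f : A ⟶ B) (x : (Fin m → A) × A) :
    equiv B (f.hom ∘ x.1, f.hom x.2) = f.hom ∘ equiv A x

namespace Splitting

/-- The splitting in which an invertible matrix maps `(w, a)` to `h (a, w₀, …, wₘ₋₁)`, so that
column `0` of `h` spans the second summand. -/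
def ofGL (h : GL (Fin (m + 1)) ℂ) : Splitting m where
  equiv A := (LinearEquiv.prodComm A (Fin m → A) A).trans
    ((Fin.consLinearEquiv A fun _ => A).trans
      (toLin'OfInv (h.map (algebraMap ℂ A)).inv_mul (h.map (algebraMap ℂ A)).mul_inv))
  equiv_map {A B} f x := by
    have hf : (h.1.map (algebraMap ℂ A)).map f.hom = h.1.map (algebraMap ℂ B) :=
      ext fun i j => f.hom.commutes (h.1 i j)
    funext i
    refine (congrFun (congrArg₂ mulVec hf.symm (Fin.comp_cons f.hom x.2 x.1).symm) i).trans ?_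
    exact (RingHom.map_mulVec f.hom.toRingHom _ _ i).symm

theorem ofGL_equiv_zero_one (h : GL (Fin (m + 1)) ℂ) (A : CommAlgCat.{0} ℂ) :
    (ofGL h).equiv A (0, 1) = constVec (h.1.col 0) A := by
  have hx : (Fin.cons 1 0 : Fin (m + 1) → A) = Pi.single 0 1 := by
    funext i
    refine Fin.cases rfl (fun i => ?_) i
    simp [Pi.single]
  refine (congrArg (h.1.map (algebraMap ℂ A)).mulVec hx).trans ?_
  rw [mulVec_single_one]
  rfl

theorem ofGL_symm_snd (h : GL (Fin (m + 1)) ℂ) (A : CommAlgCat.{0} ℂ) (x : Fin (m + 1) → A) :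
    (((ofGL h).equiv A).symm x).2 = linForm ((contra h).1.col 0) A x := by
  have hx : (((ofGL h).equiv A).symm x).2 =
      (GeneralLinearGroup.map (algebraMap ℂ A) h⁻¹).1 0 ⬝ᵥ x := rfl
  rw [hx]
  exact dotProduct_comm _ _

theorem exists_equiv_eq_constVec (v : Fin (m + 1) → ℂ) (hv : v 0 ≠ 0) :
    ∃ ψ : Splitting m, ∀ A, ψ.equiv A (0, 1) = constVec v A := by
  obtain ⟨h, rfl⟩ := exists_col_eq 0 0 v hv.isUnit
  exact ⟨ofGL h, ofGL_equiv_zero_one h⟩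

theorem exists_symm_snd_eq_linForm (l : Fin (m + 1) → ℂ) (hl : l 0 ≠ 0) :
    ∃ ψ : Splitting m, ∀ A x, ((ψ.equiv A).symm x).2 = linForm l A x := by
  obtain ⟨h, rfl⟩ := exists_col_eq 0 0 l hl.isUnit
  exact ⟨ofGL (contra h), fun A x => by rw [ofGL_symm_snd, contra_contra]⟩

variable (ψ : Splitting m) (A : CommAlgCat.{0} ℂ)

/-- The first summand of a splitting. -/
def incl : (Fin m → A) →ₗ[A] (Fin (m + 1) → A) :=
  (ψ.equiv A).toLinearMap ∘ₗ LinearMap.inl A _ _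

/-- The projection to the first summand of a splitting. -/
def fst : (Fin (m + 1) → A) →ₗ[A] (Fin m → A) :=
  LinearMap.fst A _ _ ∘ₗ (ψ.equiv A).symm.toLinearMap

theorem fst_equiv (x : (Fin m → A) × A) : ψ.fst A (ψ.equiv A x) = x.1 :=
  congrArg Prod.fst ((ψ.equiv A).symm_apply_apply x)

theorem fst_incl (w : Fin m → A) : ψ.fst A (ψ.incl A w) = w :=
  ψ.fst_equiv A (w, 0)

theorem fst_surjective : Function.Surjective (ψ.fst A) :=
  Function.RightInverse.surjective (ψ.fst_incl A)

theorem incl_injective : Function.Injective (ψ.incl A) :=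
  Function.LeftInverse.injective (ψ.fst_incl A)

theorem incl_fst_add (v : Fin (m + 1) → A) :
    ψ.incl A (ψ.fst A v) + ((ψ.equiv A).symm v).2 • ψ.equiv A (0, 1) = v := by
  obtain ⟨x, rfl⟩ := (ψ.equiv A).surjective v
  rw [fst_equiv, LinearEquiv.symm_apply_apply, incl, LinearMap.comp_apply, LinearEquiv.coe_coe,
    ← map_smul, ← map_add]
  simp

variable {A} {B : CommAlgCat.{0} ℂ} (f : A ⟶ B)

theorem symm_map (v : Fin (m + 1) → A) : (ψ.equiv B).symm (f.hom ∘ v) =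
    (f.hom ∘ ((ψ.equiv A).symm v).1, f.hom ((ψ.equiv A).symm v).2) := by
  rw [LinearEquiv.symm_apply_eq, ψ.equiv_map, LinearEquiv.apply_symm_apply]

end Splitting

end Splitting

section Points

variable {n k k₁ k₂ : ℕ} {A : CommAlgCat.{0} ℂ}

/-- The subspace of `Aⁿ` of a point of a Grassmannian. -/
abbrev grSub (w : (Gr k n).obj A) : Submodule A (Fin n → A) :=
  GrPoint.sub w

/-- The point of a Grassmannian with a given subspace. -/
def grMk {W : Submodule A (Fin n → A)} (hW : IsSubbundle k W) : (Gr k n).obj A :=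
  GrPoint.mk (E := VectBundle.trivial pt n) (A := A) PUnit.unit W hW

/-- The flag with given subspaces. -/
def flMk {V₁ V₂ : Submodule A (Fin n → A)} (h₁ : IsSubbundle k₁ V₁) (h₂ : IsSubbundle k₂ V₂)
    (h : V₁ ≤ V₂) : (Fl k₁ k₂ n).obj A :=
  ⟨(grMk h₁, grMk h₂), h⟩

/-- The coordinatewise application of a homomorphism of algebras. -/
abbrev mapVec {B : CommAlgCat.{0} ℂ} (f : A ⟶ B) (n : ℕ) :
    (Fin n → A) →ₛₗ[f.hom.toRingHom] (Fin n → B) :=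
  (VectBundle.trivial pt n).tr f (x := PUnit.unit) rfl

end Points

theorem nonempty_iso_of_bijective {X Y : CSpace} (F : X ⟶ Y)
    (hF : ∀ A, Function.Bijective (F.app A)) : Nonempty (X ≅ Y) := by
  have : IsIso F := (NatTrans.isIso_iff_isIso_app F).2 fun A => (isIso_iff_bijective _).2 (hF A)
  exact ⟨asIso F⟩

theorem isSubbundle_top {A : Type} [CommRing A] : IsSubbundle 1 (⊤ : Submodule A A) := by
  refine ⟨?_, fun p => ?_⟩
  · have := Submodule.Quotient.subsingleton_iff.2 (rfl : (⊤ : Submodule A A) = ⊤)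
    infer_instance
  · have := p.nontrivial
    rw [Module.rankAtStalk_eq_of_equiv Submodule.topEquiv, Module.rankAtStalk_self]
    rfl

section ZeroLocusQ

variable {l m k : ℕ}

/-- The bundle `𝒰 ⊕ 𝒪`. -/
abbrev tautUSum (l m : ℕ) : VectBundle (Gr l m) :=
  (tautU l m).sum (VectBundle.structureSheaf (Gr l m))

/-- The subspace of `W ⊕ A` of a point of the Grassmann bundle of `𝒰 ⊕ 𝒪` over `W`. -/
abbrev subUSum {A : CommAlgCat.{0} ℂ} (p : GrPoint k (tautUSum l m) A) :
    Submodule A (grSub p.base × A) :=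
  p.sub

namespace Splitting

variable (ψ : Splitting m) {A : CommAlgCat.{0} ℂ} (W : Submodule A (Fin m → A))

theorem isSubbundle_ker_fst : IsSubbundle 1 (LinearMap.ker (ψ.fst A)) := by
  have h : LinearMap.ker (ψ.fst A) =
      (⊤ : Submodule A A).map ((ψ.equiv A).toLinearMap ∘ₗ LinearMap.inr A _ _) := by
    rw [fst, LinearMap.ker_comp, LinearMap.ker_fst, Submodule.map_comp, ← LinearMap.range_eq_map]
    exact (Submodule.map_equiv_eq_comap_symm (ψ.equiv A) _).symm
  rw [h]
  exact isSubbundle_top.map _ (LinearMap.snd A _ _ ∘ₗ (ψ.equiv A).symm.toLinearMap) fun a =>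
    congrArg Prod.snd ((ψ.equiv A).symm_apply_apply (0, a))

/-- The embedding of `W ⊕ A` into `A^(m + 1)` given by a splitting. -/
def embed : (W × A) →ₗ[A] (Fin (m + 1) → A) :=
  (ψ.equiv A).toLinearMap ∘ₗ W.subtype.prodMap LinearMap.id

theorem embed_injective : Function.Injective (ψ.embed W) :=
  (ψ.equiv A).injective.comp (W.injective_subtype.prodMap Function.injective_id)

theorem range_embed : LinearMap.range (ψ.embed W) = W.comap (ψ.fst A) := by
  ext v
  obtain ⟨x, rfl⟩ := (ψ.equiv A).surjective v
  rw [Submodule.mem_comap, ψ.fst_equiv]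
  constructor
  · rintro ⟨y, hy⟩
    rw [← (ψ.equiv A).injective hy]
    exact y.1.2
  · exact fun h => ⟨(⟨x.1, h⟩, x.2), rfl⟩

theorem embed_map {B : CommAlgCat.{0} ℂ} (f : A ⟶ B) (w : (Gr l m).obj A) (x : grSub w × A) :
    ψ.embed (grSub ((Gr l m).map f w)) ((tautUSum l m).tr f rfl x) =
      mapVec f (m + 1) (ψ.embed (grSub w) x) :=
  ψ.equiv_map f (x.1.1, x.2)

theorem exists_retraction_embed (hW : IsSubbundle l W) :
    ∃ r : (Fin (m + 1) → A) →ₗ[A] (W × A), ∀ x, r (ψ.embed W x) = x := by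
  have := hW.projective_quotient
  obtain ⟨p, hp⟩ := exists_retraction W
  refine ⟨p.prodMap LinearMap.id ∘ₗ (ψ.equiv A).symm.toLinearMap, fun x => ?_⟩
  simp [embed, hp]

theorem comap_fst_comap_incl {V : Submodule A (Fin (m + 1) → A)}
    (hV : ψ.equiv A (0, 1) ∈ V) : (V.comap (ψ.incl A)).comap (ψ.fst A) = V := by
  ext v
  rw [Submodule.mem_comap, Submodule.mem_comap,
    ← Submodule.add_mem_iff_left V (V.smul_mem ((ψ.equiv A).symm v).2 hV), ψ.incl_fst_add]

/-- The flag `L ⊆ W ⊕ A` in `A^(m + 1)` given by `W ⊆ Aᵐ` and `L ⊆ W ⊕ A`. -/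
def flagOfUSum (p : GrPoint k (tautUSum l m) A) : (Fl k (1 + l) (m + 1)).obj A :=
  flMk (V₁ := (subUSum p).map (ψ.embed (grSub p.base)))
    (V₂ := LinearMap.range (ψ.embed (grSub p.base)))
    (by
      obtain ⟨_, _⟩ := p.base.isSubbundle.finite_projective
      obtain ⟨r, hr⟩ := ψ.exists_retraction_embed (grSub p.base) p.base.isSubbundle
      exact p.isSubbundle.map (ψ.embed (grSub p.base)) r hr)
    (by
      rw [range_embed]
      exact (IsSubbundle.comap_iff (ψ.fst_surjective A) ψ.isSubbundle_ker_fst).2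
        p.base.isSubbundle)
    LinearMap.map_le_range

theorem flagOfUSum_map {B : CommAlgCat.{0} ℂ} (f : A ⟶ B) (p : GrPoint k (tautUSum l m) A) :
    ψ.flagOfUSum (p.map f) = (Fl k (1 + l) (m + 1)).map f (ψ.flagOfUSum p) := by
  have h (L : Submodule A (grSub p.base × A)) :=
    extendSub_map (g := (tautUSum l m).tr f rfl) (fun x => (ψ.embed_map f p.base x).symm) L
  refine Fl.ext (h (subUSum p)).symm ?_
  have htop := ((tautUSum l m).isExtension f (x := p.base) rfl).extendSub_top
  refine (LinearMap.range_eq_map _).trans (.trans ?_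
    (congrArg (extendSub (mapVec f (m + 1))) (LinearMap.range_eq_map _).symm))
  exact ((h ⊤).trans (congrArg (Submodule.map _) htop)).symm

theorem flagOfUSum_injective :
    Function.Injective (ψ.flagOfUSum : GrPoint k (tautUSum l m) A → _) := by
  rintro ⟨w, L, hL⟩ ⟨w', L', hL'⟩ h
  have h₁ : Submodule.map (ψ.embed (grSub w)) L = Submodule.map (ψ.embed (grSub w')) L' :=
    congrArg flSub₁ h
  have h₂ : LinearMap.range (ψ.embed (grSub w)) = LinearMap.range (ψ.embed (grSub w')) :=
    congrArg flSub₂ h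
  rw [range_embed, range_embed] at h₂
  obtain rfl : w = w' :=
    GrPoint.ext_of_trivial (Submodule.comap_injective_of_surjective (ψ.fst_surjective A) h₂)
  obtain rfl := Submodule.map_injective_of_injective (ψ.embed_injective _) h₁
  rfl

theorem equiv_zero_one_mem_flagOfUSum (p : GrPoint k (tautUSum l m) A) :
    ψ.equiv A (0, 1) ∈ flSub₂ (ψ.flagOfUSum p) :=
  ⟨(0, 1), rfl⟩

theorem exists_flagOfUSum_eq {x : (Fl k (1 + l) (m + 1)).obj A}
    (hx : ψ.equiv A (0, 1) ∈ flSub₂ x) :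
    ∃ p : GrPoint k (tautUSum l m) A, ψ.flagOfUSum p = x := by
  let W := (flSub₂ x).comap (ψ.incl A)
  have hV₂ : W.comap (ψ.fst A) = flSub₂ x := ψ.comap_fst_comap_incl hx
  have hW : IsSubbundle l W :=
    (IsSubbundle.comap_iff (ψ.fst_surjective A) ψ.isSubbundle_ker_fst).1
      (hV₂ ▸ x.1.2.isSubbundle)
  have hV₁ : Submodule.map (ψ.embed W) ((flSub₁ x).comap (ψ.embed W)) = flSub₁ x := by
    rw [Submodule.map_comap_eq, range_embed, hV₂]
    exact inf_eq_right.2 x.2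
  obtain ⟨_, _⟩ := hW.finite_projective
  have hL : IsSubbundle k ((flSub₁ x).comap (ψ.embed W)) :=
    .of_map (ψ.embed_injective W) (by
      rw [hV₁]
      exact x.1.1.isSubbundle)
  exact ⟨GrPoint.mk (E := tautUSum l m) (grMk hW) _ hL,
    Fl.ext hV₁ ((ψ.range_embed W).trans hV₂)⟩

end Splitting

theorem mem_zeroLocus_secQ {n k₁ k₂ : ℕ} {v : Fin n → ℂ} {A : CommAlgCat.{0} ℂ}
    {x : (Fl k₁ k₂ n).obj A} :
    x ∈ (VectBundle.zeroLocus (secQ k₁ k₂ n v)).obj A ↔ constVec v A ∈ flSub₂ x :=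
  Submodule.Quotient.mk_eq_zero (flSub₂ x)

theorem nonempty_zeroLocus_secQ_iso (v : Fin (m + 1) → ℂ) (hv : v 0 ≠ 0) :
    Nonempty ((VectBundle.zeroLocus (secQ k (1 + l) (m + 1) v)).toFunctor ≅
      grassmannBundle k (tautUSum l m)) := by
  obtain ⟨ψ, hψ⟩ := Splitting.exists_equiv_eq_constVec v hv
  have mem_iff {A : CommAlgCat.{0} ℂ} {x : (Fl k (1 + l) (m + 1)).obj A} :
      x ∈ (VectBundle.zeroLocus (secQ k (1 + l) (m + 1) v)).obj A ↔
        ψ.equiv A (0, 1) ∈ flSub₂ x := by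
    rw [mem_zeroLocus_secQ, hψ]
  let F : grassmannBundle k (tautUSum l m) ⟶
      (VectBundle.zeroLocus (secQ k (1 + l) (m + 1) v)).toFunctor :=
    { app A := ↾fun p => ⟨ψ.flagOfUSum p, mem_iff.2 (ψ.equiv_zero_one_mem_flagOfUSum p)⟩
      naturality A B f := by
        ext p
        exact Subtype.ext (ψ.flagOfUSum_map f p) }
  refine (nonempty_iso_of_bijective F fun A => ⟨fun p q h => ?_, fun x => ?_⟩).map Iso.symm
  · exact ψ.flagOfUSum_injective (congrArg Subtype.val h)
  · obtain ⟨p, hp⟩ := ψ.exists_flagOfUSum_eq (mem_iff.1 x.2)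
    exact ⟨p, Subtype.ext hp⟩

end ZeroLocusQ

section Twist

open TensorProduct

variable {A Q N : Type} [CommRing A] [AddCommGroup Q] [Module A Q] [AddCommGroup N] [Module A N]

/-- The distributivity isomorphism `(Q ⊕ A) ⊗ N ≅ (Q ⊗ N) ⊕ N`. -/
def sumTensorEquiv (Q N : Type) [AddCommGroup Q] [Module A Q] [AddCommGroup N] [Module A N] :
    (Q × A) ⊗[A] N ≃ₗ[A] (Q ⊗[A] N) × N :=
  (TensorProduct.prodLeft A A Q A N).trans
    ((LinearEquiv.refl A _).prodCongr (TensorProduct.lid A N))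

/-- The submodule `S ⊗ N` of `(Q ⊗ N) ⊕ N`, for a submodule `S` of `Q ⊕ A`. -/
def twistSub (N : Type) [AddCommGroup N] [Module A N] (S : Submodule A (Q × A)) :
    Submodule A ((Q ⊗[A] N) × N) :=
  Submodule.map₂ ((TensorProduct.mk A (Q × A) N).compr₂ (sumTensorEquiv Q N).toLinearMap) S ⊤

theorem map_sumTensorEquiv_tensorSub (S : Submodule A (Q × A)) :
    (tensorSub N S).map (sumTensorEquiv Q N).toLinearMap = twistSub N S :=
  Submodule.map_map₂ _ _ _ _

theorem twistSub_injective [Module.Invertible A N] :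
    Function.Injective (twistSub N : Submodule A (Q × A) → _) := by
  intro S T h
  rw [← map_sumTensorEquiv_tensorSub, ← map_sumTensorEquiv_tensorSub] at h
  exact tensorSub_injective (Submodule.map_injective_of_injective (sumTensorEquiv Q N).injective h)

variable [Module.Finite A Q] [Module.Projective A Q] [Module.Invertible A N] {j : ℕ}

theorem isSubbundle_twistSub {S : Submodule A (Q × A)} (hS : IsSubbundle j S) :
    IsSubbundle j (twistSub N S) := by
  rw [← map_sumTensorEquiv_tensorSub]
  exact (isSubbundle_tensorSub hS).map _ (sumTensorEquiv Q N).symm.toLinearMap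
    (sumTensorEquiv Q N).symm_apply_apply

theorem exists_twistSub_eq {L : Submodule A ((Q ⊗[A] N) × N)} (hL : IsSubbundle j L) :
    ∃ S : Submodule A (Q × A), IsSubbundle j S ∧ twistSub N S = L := by
  have hL' : (L.comap (sumTensorEquiv Q N).toLinearMap).map (sumTensorEquiv Q N).toLinearMap = L :=
    Submodule.map_comap_eq_of_surjective (sumTensorEquiv Q N).surjective L
  obtain ⟨S, hS, hSL⟩ := exists_tensorSub_eq
    (IsSubbundle.of_map (sumTensorEquiv Q N).injective (hL'.symm ▸ hL))
  refine ⟨S, hS, ?_⟩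
  rw [← map_sumTensorEquiv_tensorSub, hSL, hL']

end Twist

section ZeroLocusU

open TensorProduct

variable {k m j : ℕ}

/-- The bundle `𝒬(-1) ⊕ 𝒪(-1)`. -/
abbrev tautQTwist (k m : ℕ) : VectBundle (Gr k m) := ((tautQ k m).tensor (grO k m)).sum (grO k m)

theorem extendSub_twistSub {A B : CommAlgCat.{0} ℂ} (f : A ⟶ B) {w : (Gr k m).obj A}
    {w' : (Gr k m).obj B} (h : (Gr k m).map f w = w')
    (S : Submodule A ((tautQ k m).fib w × A)) :
    extendSub ((tautQTwist k m).tr f h) (twistSub ((grO k m).fib w) S) =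
      twistSub ((grO k m).fib w')
        (extendSub (((tautQ k m).sum (VectBundle.structureSheaf _)).tr f h) S) := by
  have htop : extendSub ((grO k m).tr f h) ⊤ = ⊤ := ((grO k m).isExtension f h).extendSub_top
  refine (extendSub_map₂ (g := ((tautQ k m).sum (VectBundle.structureSheaf _)).tr f h)
    (g' := (grO k m).tr f h) (fun q y => ?_) S ⊤).trans (congrArg (Submodule.map₂ _ _) htop)
  exact Prod.ext rfl (((grO k m).tr f h).map_smulₛₗ q.2 y)

namespace Splitting

variable (ψ : Splitting m) {A : CommAlgCat.{0} ℂ} (W : Submodule A (Fin m → A))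

/-- The projection of `A^(m + 1)` to `Aᵐ / W ⊕ A` given by a splitting. -/
def proj : (Fin (m + 1) → A) →ₗ[A] ((Fin m → A) ⧸ W) × A :=
  W.mkQ.prodMap LinearMap.id ∘ₗ (ψ.equiv A).symm.toLinearMap

theorem proj_surjective : Function.Surjective (ψ.proj W) :=
  (W.mkQ_surjective.prodMap Function.surjective_id).comp (ψ.equiv A).symm.surjective

theorem ker_proj : LinearMap.ker (ψ.proj W) = W.map (ψ.incl A) := by
  rw [proj, LinearMap.ker_comp, LinearMap.ker_prodMap, Submodule.ker_mkQ, LinearMap.ker_id, incl,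
    Submodule.map_comp, Submodule.map_inl]
  exact (Submodule.map_equiv_eq_comap_symm (ψ.equiv A) _).symm

theorem comap_map_proj {V : Submodule A (Fin (m + 1) → A)} (h : W.map (ψ.incl A) ≤ V) :
    (V.map (ψ.proj W)).comap (ψ.proj W) = V := by
  rw [Submodule.comap_map_eq, ψ.ker_proj, sup_eq_left.2 h]

/-- The submodule `V / W ⊗ N` of `(Aᵐ / W ⊗ N) ⊕ N`, for a submodule `V` of `A^(m + 1)`. -/
def quotTwist (N : Type) [AddCommGroup N] [Module A N] (V : Submodule A (Fin (m + 1) → A)) :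
    Submodule A ((((Fin m → A) ⧸ W) ⊗[A] N) × N) :=
  twistSub N (V.map (ψ.proj W))

variable {W} {N : Type} [AddCommGroup N] [Module A N] [Module.Invertible A N]

theorem quotTwist_injective {V V' : Submodule A (Fin (m + 1) → A)} (h : W.map (ψ.incl A) ≤ V)
    (h' : W.map (ψ.incl A) ≤ V') (hV : ψ.quotTwist W N V = ψ.quotTwist W N V') : V = V' := by
  rw [← ψ.comap_map_proj W h, twistSub_injective hV, ψ.comap_map_proj W h']

theorem isSubbundle_quotTwist (hW : IsSubbundle k W) {V : Submodule A (Fin (m + 1) → A)}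
    (hV : IsSubbundle (k + j) V) (h : W.map (ψ.incl A) ≤ V) :
    IsSubbundle j (ψ.quotTwist W N V) := by
  have := hW.projective_quotient
  refine isSubbundle_twistSub ((IsSubbundle.comap_iff (k := k) (ψ.proj_surjective W) ?_).1 ?_)
  · rw [ker_proj]
    exact hW.map _ _ (ψ.fst_incl A)
  · rwa [ψ.comap_map_proj W h]

theorem exists_quotTwist_eq (hW : IsSubbundle k W)
    {L : Submodule A ((((Fin m → A) ⧸ W) ⊗[A] N) × N)} (hL : IsSubbundle j L) :
    ∃ V, IsSubbundle (k + j) V ∧ W.map (ψ.incl A) ≤ V ∧ ψ.quotTwist W N V = L := by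
  have := hW.projective_quotient
  obtain ⟨S, hS, hSL⟩ := exists_twistSub_eq hL
  refine ⟨S.comap (ψ.proj W), (IsSubbundle.comap_iff (ψ.proj_surjective W) ?_).2 hS, ?_, ?_⟩
  · rw [ker_proj]
    exact hW.map _ _ (ψ.fst_incl A)
  · rw [← ker_proj]
    exact LinearMap.ker_le_comap _
  · rw [quotTwist, Submodule.map_comap_eq_of_surjective (ψ.proj_surjective W), hSL]

theorem extendSub_quotTwist {B : CommAlgCat.{0} ℂ} (f : A ⟶ B) {w : (Gr k m).obj A}
    {w' : (Gr k m).obj B} (h : (Gr k m).map f w = w') (V : Submodule A (Fin (m + 1) → A)) :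
    extendSub ((tautQTwist k m).tr f h) (ψ.quotTwist (grSub w) ((grO k m).fib w) V) =
      ψ.quotTwist (grSub w') ((grO k m).fib w') (extendSub (mapVec f (m + 1)) V) := by
  refine (extendSub_twistSub f h _).trans (congrArg (twistSub ((grO k m).fib w')) ?_)
  refine extendSub_map (g := mapVec f (m + 1)) (α := ψ.proj (grSub w)) (β := ψ.proj (grSub w'))
    (fun v => ?_) V
  exact congrArg (Prod.map (Submodule.Quotient.mk (p := grSub w')) id) (ψ.symm_map f v).symm

/-- The first subspace of a flag lies in the first summand of a splitting. -/
def Contains (x : (Fl k (k + j) (m + 1)).obj A) : Prop :=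
  ∀ v ∈ flSub₁ x, ((ψ.equiv A).symm v).2 = 0

namespace Contains

variable {ψ} {x : (Fl k (k + j) (m + 1)).obj A}

theorem map_fst_map_incl (hx : ψ.Contains x) :
    ((flSub₁ x).map (ψ.fst A)).map (ψ.incl A) = flSub₁ x := by
  have h (v) (hv : v ∈ flSub₁ x) : ψ.incl A (ψ.fst A v) = v := by
    simpa only [hx v hv, zero_smul, add_zero] using ψ.incl_fst_add A v
  ext v
  constructor
  · rintro ⟨_, ⟨v, hv, rfl⟩, rfl⟩
    rwa [h v hv]
  · exact fun hv => ⟨_, ⟨v, hv, rfl⟩, h v hv⟩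

/-- The first subspace of a flag, as a subspace of the first summand. -/
def base (hx : ψ.Contains x) : (Gr k m).obj A :=
  grMk (W := (flSub₁ x).map (ψ.fst A)) (.of_map (ψ.incl_injective A) (by
    rw [hx.map_fst_map_incl]
    exact x.1.1.isSubbundle))

theorem map_incl_base (hx : ψ.Contains x) : (grSub hx.base).map (ψ.incl A) = flSub₁ x :=
  hx.map_fst_map_incl

theorem map_incl_base_le (hx : ψ.Contains x) : (grSub hx.base).map (ψ.incl A) ≤ flSub₂ x :=
  hx.map_incl_base.trans_le x.2

/-- The point `V₂ / V₁ ⊗ det V₁` of the Grassmann bundle of `𝒬(-1) ⊕ 𝒪(-1)` over `V₁`. -/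
def toGr (hx : ψ.Contains x) : GrPoint j (tautQTwist k m) A :=
  GrPoint.mk (E := tautQTwist k m) hx.base
    (ψ.quotTwist (grSub hx.base) ((grO k m).fib hx.base) (flSub₂ x))
    (ψ.isSubbundle_quotTwist hx.base.isSubbundle x.1.2.isSubbundle hx.map_incl_base_le)

theorem toGr_eq (hx : ψ.Contains x) {w : (Gr k m).obj A}
    {L : Submodule A ((tautQTwist k m).fib w)} (hL : IsSubbundle j L)
    (h₁ : flSub₁ x = (grSub w).map (ψ.incl A))
    (h₂ : ψ.quotTwist (grSub w) ((grO k m).fib w) (flSub₂ x) = L) :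
    hx.toGr = GrPoint.mk (E := tautQTwist k m) w L hL := by
  obtain rfl : hx.base = w := GrPoint.ext_of_trivial
    (Submodule.map_injective_of_injective (ψ.incl_injective A) (hx.map_incl_base.trans h₁))
  obtain rfl := h₂
  rfl

theorem exists_toGr_eq (ψ : Splitting m) (p : GrPoint j (tautQTwist k m) A) :
    ∃ (x : (Fl k (k + j) (m + 1)).obj A) (hx : ψ.Contains x), hx.toGr = p := by
  have hW : IsSubbundle k (grSub p.base) := p.base.isSubbundle
  obtain ⟨V, hV, h, hVp⟩ := ψ.exists_quotTwist_eq hW p.isSubbundle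
  let x : (Fl k (k + j) (m + 1)).obj A := flMk (hW.map (ψ.incl A) _ (ψ.fst_incl A)) hV h
  have hx : ψ.Contains x := by
    rintro _ ⟨w, -, rfl⟩
    exact congrArg Prod.snd ((ψ.equiv A).symm_apply_apply (w, 0))
  exact ⟨x, hx, hx.toGr_eq p.isSubbundle rfl hVp⟩

theorem eq_of_toGr_eq {y : (Fl k (k + j) (m + 1)).obj A} (hx : ψ.Contains x) (hy : ψ.Contains y)
    (h : hx.toGr = hy.toGr) : x = y := by
  have h₁ : flSub₁ x = flSub₁ y :=
    hx.map_incl_base.symm.trans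
      ((congrArg (fun p => (grSub p.base).map (ψ.incl A)) h).trans hy.map_incl_base)
  have h₂ (p : GrPoint j (tautQTwist k m) A) (hp : hx.toGr = p) :
      ψ.quotTwist (grSub p.base) ((grO k m).fib p.base) (flSub₂ x) = p.sub := by
    obtain rfl := hp
    rfl
  have h₃ : ψ.quotTwist (grSub hy.base) ((grO k m).fib hy.base) (flSub₂ x) =
      ψ.quotTwist (grSub hy.base) ((grO k m).fib hy.base) (flSub₂ y) := h₂ hy.toGr h
  exact Fl.ext h₁ (ψ.quotTwist_injective
    (hy.map_incl_base.trans_le (h₁.symm.trans_le x.2)) hy.map_incl_base_le h₃)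

theorem toGr_map (hx : ψ.Contains x) {B : CommAlgCat.{0} ℂ} (f : A ⟶ B)
    (hy : ψ.Contains ((Fl k (k + j) (m + 1)).map f x)) : hx.toGr.map f = hy.toGr := by
  have hb : (Gr k m).map f hx.base = hy.base := GrPoint.ext_of_trivial
    (extendSub_map (g := mapVec f (m + 1)) (g' := mapVec f m) (α := ψ.fst A) (β := ψ.fst B)
      (fun v => (congrArg Prod.fst (ψ.symm_map f v)).symm) (flSub₁ x))
  exact GrPoint.map_eq f hx.toGr hy.toGr hb (ψ.extendSub_quotTwist f hb (flSub₂ x))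

end Contains

end Splitting

theorem mem_zeroLocus_secU {n k₁ k₂ : ℕ} {l : Fin n → ℂ} {A : CommAlgCat.{0} ℂ}
    {x : (Fl k₁ k₂ n).obj A} :
    x ∈ (VectBundle.zeroLocus (secU k₁ k₂ n l)).obj A ↔ ∀ v ∈ flSub₁ x, linForm l A v = 0 := by
  refine (LinearMap.ext_iff (f := (linForm l A).comp (flSub₁ x).subtype) (g := 0)).trans ?_
  exact Subtype.forall

theorem nonempty_zeroLocus_secU_iso (l : Fin (m + 1) → ℂ) (hl : l 0 ≠ 0) :
    Nonempty ((VectBundle.zeroLocus (secU k (k + j) (m + 1) l)).toFunctor ≅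
      grassmannBundle j (tautQTwist k m)) := by
  obtain ⟨ψ, hψ⟩ := Splitting.exists_symm_snd_eq_linForm l hl
  have mem_iff {A : CommAlgCat.{0} ℂ} {x : (Fl k (k + j) (m + 1)).obj A} :
      x ∈ (VectBundle.zeroLocus (secU k (k + j) (m + 1) l)).obj A ↔ ψ.Contains x := by
    simp only [mem_zeroLocus_secU, Splitting.Contains, hψ]
  let F : (VectBundle.zeroLocus (secU k (k + j) (m + 1) l)).toFunctor ⟶
      grassmannBundle j (tautQTwist k m) :=
    { app A := ↾fun x => (mem_iff.1 x.2).toGr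
      naturality A B f := by
        ext x
        exact ((mem_iff.1 x.2).toGr_map f _).symm }
  refine nonempty_iso_of_bijective F fun A => ⟨fun x y h => ?_, fun p => ?_⟩
  · exact Subtype.ext ((mem_iff.1 x.2).eq_of_toGr_eq (mem_iff.1 y.2) h)
  · obtain ⟨x, hx, rfl⟩ := Splitting.Contains.exists_toGr_eq ψ p
    exact ⟨⟨x, mem_iff.2 hx⟩, rfl⟩

end ZeroLocusU

end

theorem lemma2p5 (k₁ k₂ n : ℕ) (hk₁ : 0 < k₁) (hk : k₁ < k₂) (hk₂ : k₂ < n) :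
    HoldsForGeneral (fun s : (flQ₂ k₁ k₂ n).globalSections =>
      Nonempty ((VectBundle.zeroLocus s).toFunctor ≅
        grassmannBundle k₁
          ((tautU (k₂ - 1) (n - 1)).sum (VectBundle.structureSheaf (Gr (k₂ - 1) (n - 1)))))) ∧
    HoldsForGeneral (fun s : (flU₁ k₁ k₂ n).dual.globalSections =>
      Nonempty ((VectBundle.zeroLocus s).toFunctor ≅
        grassmannBundle (k₂ - k₁)
          (((tautQ k₁ (n - 1)).tensor (grO k₁ (n - 1))).sum (grO k₁ (n - 1))))) := by
  obtain ⟨m, rfl⟩ : ∃ m, n = m + 1 := ⟨n - 1, by omega⟩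
  constructor
  · obtain ⟨l, rfl⟩ : ∃ l, k₂ = 1 + l := ⟨k₂ - 1, by omega⟩
    rw [Nat.add_sub_cancel_left]
    exact HoldsForGeneral.of_linearEquiv
      (LinearEquiv.ofBijective _ (secQ_bijective hk.le hk₂)) 0 nonempty_zeroLocus_secQ_iso
  · obtain ⟨j, rfl⟩ : ∃ j, k₂ = k₁ + j := ⟨k₂ - k₁, by omega⟩
    rw [Nat.add_sub_cancel_left]
    exact HoldsForGeneral.of_linearEquiv
      (LinearEquiv.ofBijective _ (secU_bijective hk.le hk₂.le hk₁)) 0 nonempty_zeroLocus_secU_iso
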